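/- Let $M$ be a smooth manifold (Hausdorff, second countable, finite-dimensional) and let $\pi:E(\pi)\to M$ be a smooth real vector bundle of finite rank. Write $C^\infty(\pi)$ for its smooth sections, $\mathrm{End}(\pi)$ for its smooth bundle endomorphisms, and $\Sigma_k$, $\Sigma^k$ for the $C^\infty(M)$-modules of smooth symmetric $k$-vector fields and symmetric $k$-forms on $M$; tensor products are over $C^\infty(M)$. Let $\mathbf{Diff}_k(\pi,\pi)$ be the set of $\mathbb R$-linear differential operators $C^\infty(\pi)\to C^\infty(\pi)$ of order at most $k$, i.e. those all of whose $(k+1)$-fold commutators with multiplications by functions vanish. The symbol of $A\in\mathbf{Diff}_2(\pi,\pi)$ is the tensor $\sigma_2\in\mathrm{End}(\pi)\otimes\Sigma_2$ with $\langle\sigma_2,df\cdot dg\rangle=[[A,g],f]$ for all $f,g\in C^\infty(M)$, where $\langle X\cdot Y,\theta\cdot\eta\rangle=\theta(X)\eta(Y)+\theta(Y)\eta(X)$; the symbol of $B\in\mathbf{Diff}_1(\pi,\pi)$ is the tensor $\tau\in\mathrm{End}(\pi)\otimes\Sigma_1$ with $\langle\tau,df\rangle=[B,f]$. The symbol $\sigma_2$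 is called regular if the map $$\mathrm{End}(\pi)\otimes\Sigma^1\to\mathrm{End}(\pi)\otimes\Sigma_1,\qquad \alpha\mapsto\langle\sigma_2,\alpha\rangle,$$ is an isomorphism, where $\langle\cdot,\cdot\rangle$ composes endomorphisms (that of $\sigma_2$ after that of $\alpha$) and contracts tensors, so that $\langle\langle\sigma_2,a\otimes\theta\rangle,\eta\rangle=\langle\sigma_2,\theta\cdot\eta\rangle\circ a$. Given a smooth connection $\nabla_c$ in the cotangent bundle and a smooth connection $\nabla$ in $\pi$, let $d_\nabla:C^\infty(\pi)\to C^\infty(\pi)\otimes\Sigma^1$ be the covariant differential, extended to $d_\nabla:C^\infty(\pi)\otimes\Sigma^1\to C^\infty(\pi)\otimes\Sigma^2$ by $d_\nabla(s\otimes\theta)=d_\nabla s\cdot\theta+s\otimes\mathrm{Sym}(\nabla_c\theta)$. Put $Q_\nabla(\sigma_2)(s)=\tfrac1{2}\langle\sigma_2,d_\nabla^2 s\rangle$. For $A\in\mathbf{Diff}_2(\pi,\pi)$ with symbol $\sigma_2$, the operator $A-Q_\nabla(\sigma_2)$ has order at most $1$; its symbol $\sigma_1(A,\nabla)\in\mathrm{End}(\pi)\otimes\Sigma_1$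 is called the subsymbol of $A$. Theorem. Let $A\in\mathbf{Diff}_2(\pi,\pi)$ be an operator with regular symbol. Then for every smooth connection $\nabla_c$ in the cotangent bundle of $M$ there exists a unique smooth connection $\nabla$ in $\pi$ such that $\sigma_1(A,\nabla)=0$. -/

import Mathlib

open Bundle
open scoped Manifold ContDiff

noncomputable section

section Definitions

variable {E : Type*} [NormedAddCommGroup E] [NormedSpace ℝ E] [FiniteDimensional ℝ E]
  {M : Type*} [TopologicalSpace M] [ChartedSpace E M] [IsManifold 𝓘(ℝ, E) ∞ M]
  {F : Type*} [NormedAddCommGroup F] [NormedSpace ℝ F]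
  {V : M → Type*} [TopologicalSpace (TotalSpace F V)]
  [∀ x, AddCommGroup (V x)] [∀ x, Module ℝ (V x)] [∀ x, TopologicalSpace (V x)]
  [∀ x, IsTopologicalAddGroup (V x)] [∀ x, ContinuousSMul ℝ (V x)]
  [FiberBundle F V] [VectorBundle ℝ F V]

variable (E) in
/-- The fibre at `x` of the cotangent bundle. -/
abbrev Cotangent (x : M) : Type _ := TangentSpace 𝓘(ℝ, E) x →L[ℝ] ℝ

variable (E F V) in
/-- Smooth sections of the vector bundle `V`. -/
abbrev Sections : Type _ := Cₛ^∞⟮𝓘(ℝ, E); F, V⟯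

variable (E M) in
/-- Smooth vector fields on `M`. -/
abbrev VectorFields : Type _ := Cₛ^∞⟮𝓘(ℝ, E); E, fun x : M ↦ TangentSpace 𝓘(ℝ, E) x⟯

variable (E M) in
/-- Smooth differential `1`-forms on `M`. -/
abbrev OneForms : Type _ := Cₛ^∞⟮𝓘(ℝ, E); E →L[ℝ] ℝ, fun x : M ↦ Cotangent E x⟯

variable (E F V) in
/-- `s` is a smooth section of the vector bundle `V`. -/
def IsSmoothSection (s : Π x : M, V x) : Prop :=
  ContMDiff 𝓘(ℝ, E) (𝓘(ℝ, E).prod 𝓘(ℝ, F)) ∞ (fun x ↦ TotalSpace.mk' F x (s x))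

variable (E F V) in
/-- `End(π) ⊗ Σ¹`: smooth sections of the bundle `T*M ⊗ End(V)`, that is, families of linear maps
`TₓM → End(Vₓ)` whose values on smooth vector fields and smooth sections are smooth. -/
@[ext]
structure EndForms where
  /-- The value at a point. -/
  toFun : Π x : M, TangentSpace 𝓘(ℝ, E) x →ₗ[ℝ] Module.End ℝ (V x)
  smooth : ∀ (X : VectorFields E M) (s : Sections E F V),
    IsSmoothSection E F V (fun x ↦ toFun x (X x) (s x))

variable (E F V) in
/-- `End(π) ⊗ Σ₁`: smooth sections of the bundle `TM ⊗ End(V)`, that is, families of linear maps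
`T*ₓM → End(Vₓ)` whose values on smooth `1`-forms and smooth sections are smooth. -/
@[ext]
structure SymbolsOne where
  /-- The value at a point. -/
  toFun : Π x : M, Cotangent E x →ₗ[ℝ] Module.End ℝ (V x)
  smooth : ∀ (θ : OneForms E M) (s : Sections E F V),
    IsSmoothSection E F V (fun x ↦ toFun x (θ x) (s x))

variable (E F V) in
/-- `End(π) ⊗ Σ₂`: smooth sections of the bundle `S²TM ⊗ End(V)`, that is, families of symmetric
bilinear maps `T*ₓM × T*ₓM → End(Vₓ)` whose values on smooth `1`-forms and smooth sections are
smooth. Here `σ x θ η` is the pairing `⟨σ, θ · η⟩` with the product `θ · η` in the symmetric algebra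
of `T*ₓM`, where `⟨X · Y, θ · η⟩ = θ(X) η(Y) + θ(Y) η(X)`. -/
@[ext]
structure SymbolsTwo where
  /-- The value at a point. -/
  toFun : Π x : M, Cotangent E x →ₗ[ℝ] Cotangent E x →ₗ[ℝ] Module.End ℝ (V x)
  symm : ∀ x θ η, toFun x θ η = toFun x η θ
  smooth : ∀ (θ η : OneForms E M) (s : Sections E F V),
    IsSmoothSection E F V (fun x ↦ toFun x (θ x) (η x) (s x))

instance : CoeFun (EndForms E F V)
    (fun _ ↦ Π x : M, TangentSpace 𝓘(ℝ, E) x →ₗ[ℝ] Module.End ℝ (V x)) := ⟨EndForms.toFun⟩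

instance : CoeFun (SymbolsOne E F V)
    (fun _ ↦ Π x : M, Cotangent E x →ₗ[ℝ] Module.End ℝ (V x)) := ⟨SymbolsOne.toFun⟩

instance : CoeFun (SymbolsTwo E F V)
    (fun _ ↦ Π x : M, Cotangent E x →ₗ[ℝ] Cotangent E x →ₗ[ℝ] Module.End ℝ (V x)) :=
  ⟨SymbolsTwo.toFun⟩

instance : Zero (SymbolsOne E F V) :=
  ⟨⟨fun _ ↦ 0, fun _ _ ↦ contMDiff_zeroSection ℝ V⟩⟩

/-- A basis of the tangent space at `x`. -/
def frame (x : M) :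
    Module.Basis (Fin (Module.finrank ℝ E)) ℝ (TangentSpace 𝓘(ℝ, E) x) :=
  Module.finBasis ℝ E

/-- The basis of the cotangent space at `x` that is dual to `frame x`. -/
def coframe (x : M) (i : Fin (Module.finrank ℝ E)) : Cotangent E x :=
  have : T2Space (TangentSpace 𝓘(ℝ, E) x) := inferInstanceAs (T2Space E)
  have : FiniteDimensional ℝ (TangentSpace 𝓘(ℝ, E) x) := inferInstanceAs (FiniteDimensional ℝ E)
  LinearMap.toContinuousLinearMap ((frame (E := E) x).coord i)

/-! ### Differential operators and their symbols -/

/-- The section `f s`, for a smooth function `f` and a smooth section `s`. -/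
def funSmul (f : C^∞⟮𝓘(ℝ, E), M; 𝓘(ℝ, ℝ), ℝ⟯) (s : Sections E F V) : Sections E F V :=
  ⟨fun x ↦ f x • s x, f.contMDiff.smul_section s.contMDiff⟩

/-- The commutator `B ∘ f - f ∘ B` of an operator on sections with the multiplication by `f`. -/
def funCommutator (f : C^∞⟮𝓘(ℝ, E), M; 𝓘(ℝ, ℝ), ℝ⟯) (B : Sections E F V → Π x, V x) :
    Sections E F V → Π x, V x :=
  fun s x ↦ B (funSmul f s) x - f x • B s x

/-- `B` has order at most `k`: its `(k+1)`-fold commutators with functions vanish. -/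
def HasOrderLE : ℕ → (Sections E F V → Π x, V x) → Prop
  | 0, B => ∀ f, funCommutator f B = 0
  | k + 1, B => ∀ f, HasOrderLE k (funCommutator f B)

/-- `Diff_k(π, π)`: `ℝ`-linear operators on smooth sections, of order at most `k`. -/
def IsDiffOp (k : ℕ) (A : Sections E F V →ₗ[ℝ] Sections E F V) : Prop :=
  HasOrderLE k (fun s ↦ ⇑(A s))

/-- `τ` is the symbol of the first order operator `B`: `⟨τ, df⟩ = [B, f]`. -/
def IsSymbolOne (B : Sections E F V → Π x, V x) (τ : SymbolsOne E F V) : Prop :=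
  ∀ (f : C^∞⟮𝓘(ℝ, E), M; 𝓘(ℝ, ℝ), ℝ⟯) (s : Sections E F V) (x : M),
    funCommutator f B s x = τ x (mvfderiv 𝓘(ℝ, E) f x) (s x)

/-- `σ` is the symbol of the second order operator `B`: `⟨σ, df · dg⟩ = [[B, g], f]`. In
particular, the value of the symbol on `df²` is `(1/2!) [[B, f], f]`. -/
def IsSymbolTwo (B : Sections E F V → Π x, V x) (σ : SymbolsTwo E F V) : Prop :=
  ∀ (f g : C^∞⟮𝓘(ℝ, E), M; 𝓘(ℝ, ℝ), ℝ⟯) (s : Sections E F V) (x : M),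
    funCommutator f (funCommutator g B) s x =
      σ x (mvfderiv 𝓘(ℝ, E) f x) (mvfderiv 𝓘(ℝ, E) g x) (s x)

/-- The pairing `⟨σ, α⟩` of `σ ∈ S²TₓM ⊗ End(Vₓ)` and `α ∈ T*ₓM ⊗ End(Vₓ)`, an element of
`TₓM ⊗ End(Vₓ)`: the endomorphisms are composed, and the tensors contracted. -/
def pairing (x : M) (σ : Cotangent E x →ₗ[ℝ] Cotangent E x →ₗ[ℝ] Module.End ℝ (V x))
    (α : TangentSpace 𝓘(ℝ, E) x →ₗ[ℝ] Module.End ℝ (V x)) :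
    Cotangent E x →ₗ[ℝ] Module.End ℝ (V x) :=
  ∑ i, (LinearMap.mulRight ℝ (α (frame x i))) ∘ₗ σ (coframe x i)

/-- The symbol `σ` is regular: `α ↦ ⟨σ, α⟩` is an isomorphism (that is, bijective) from
`End(π) ⊗ Σ¹` to `End(π) ⊗ Σ₁`. -/
def IsRegularSymbol (σ : SymbolsTwo E F V) : Prop :=
  ∀ τ : SymbolsOne E F V, ∃! α : EndForms E F V, ∀ x, pairing x (σ x) (α x) = τ x

/-! ### Quantization and subsymbols -/

/-- The value at `x` of the covariant derivative of a `V`-valued `1`-form `β`, for the connection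
in `T*M ⊗ V` induced by `Dc` in `T*M` and `D` in `V`: the vector `X` is the direction of
differentiation and `Y` the argument of the form. Near `x`, one has `β = ∑ᵢ β(eᵢ) ⊗ θⁱ` with a local
frame `eᵢ` and the dual coframe `θⁱ`; the `i`-th term is
`∇(β(eᵢ)) ⊗ θⁱ + β(eᵢ) ⊗ ∇θⁱ`, evaluated at `X` and `Y`. -/
def covDerivForm (Dc : CovariantDerivative 𝓘(ℝ, E) (E →L[ℝ] ℝ) (fun x : M ↦ Cotangent E x))
    (D : CovariantDerivative 𝓘(ℝ, E) F V)
    (β : Π x : M, TangentSpace 𝓘(ℝ, E) x →L[ℝ] V x) (x : M) (X Y : TangentSpace 𝓘(ℝ, E) x) : V x :=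
  ∑ i, (coframe x i Y • D (fun y ↦ β y (FiberBundle.extend E (frame x i) y)) x X +
    (Dc (FiberBundle.extend (E := fun x : M ↦ Cotangent E x) (E →L[ℝ] ℝ) (coframe x i)) x X) Y •
      β x (frame x i))

/-- The symmetrized second covariant derivative `(d_∇)² s`, with values in `S²T*M ⊗ V`, as a
symmetric bilinear form (the product `θ · η` is the form
`(X, Y) ↦ (θ(X) η(Y) + θ(Y) η(X)) / 2`). -/
def symSecondDeriv
    (Dc : CovariantDerivative 𝓘(ℝ, E) (E →L[ℝ] ℝ) (fun x : M ↦ Cotangent E x))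
    (D : CovariantDerivative 𝓘(ℝ, E) F V) (s : Sections E F V) (x : M)
    (X Y : TangentSpace 𝓘(ℝ, E) x) : V x :=
  (1 / 2 : ℝ) • (covDerivForm Dc D (D s) x X Y + covDerivForm Dc D (D s) x Y X)

/-- The quantization `Q_∇(σ)(s) = (1/2!) ⟨σ, (d_∇)² s⟩` of a second order symbol. -/
def quantizeTwo (Dc : CovariantDerivative 𝓘(ℝ, E) (E →L[ℝ] ℝ) (fun x : M ↦ Cotangent E x))
    (D : CovariantDerivative 𝓘(ℝ, E) F V) (σ : SymbolsTwo E F V) :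
    Sections E F V → Π x, V x :=
  fun s x ↦ (1 / 2 : ℝ) • ∑ i, ∑ j, σ x (coframe x i) (coframe x j)
    (symSecondDeriv Dc D s x (frame x i) (frame x j))

/-- `τ` is the subsymbol `σ₁(A, ∇)` of the second order operator `A` with symbol `σ`: the symbol of
the first order operator `A - Q_∇(σ)`. -/
def IsSubsymbolOne (Dc : CovariantDerivative 𝓘(ℝ, E) (E →L[ℝ] ℝ) (fun x : M ↦ Cotangent E x))
    (D : CovariantDerivative 𝓘(ℝ, E) F V) (A : Sections E F V →ₗ[ℝ] Sections E F V)
    (σ : SymbolsTwo E F V) (τ : SymbolsOne E F V) : Prop :=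
  IsSymbolOne (fun s x ↦ A s x - quantizeTwo Dc D σ s x) τ

end Definitions

end

/-! The connections in π form an affine space over End(π) ⊗ Σ¹, and the subsymbol is an affine
function of the connection. Indeed the Leibniz rule, applied twice, gives [Q_∇(σ), f] s = ⟨σ, df ·
∇s⟩ + ½ ⟨σ, ∇_c df⟩ s (`funCommutator_quantizeTwo`), where ∇ occurs only in the first term.
Replacing ∇ by ∇ + α therefore adds ⟨σ, α⟩ to the symbol of the quantization, so that σ₁(A, ∇ + α) =
σ₁(A, ∇) − ⟨σ, α⟩ (`funCommutator_quantizeTwo_of_eq_add`). Regularity makes α ↦ ⟨σ, α⟩ bijective: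
surjectivity yields a correction that kills the subsymbol of any initial connection, injectivity
yields uniqueness.

Two existence results are needed. An initial connection is glued from local flat ones by a partition
of unity (`exists_contMDiffCovariantDerivative`). The subsymbol exists as a smooth tensor
(`exists_isSubsymbolOne`) because [[A, f], g] and [[Q_∇(σ), f], g] both equal ⟨σ, df · dg⟩: hence [A
− Q_∇(σ), f] is linear over functions in the section and a derivation in f. By locality and
Hadamard's lemma such an operation depends at x only on the differential of f and the value of the
section at x. -/

open Bundle
open scoped Manifold ContDiff Topology

set_option linter.unusedSectionVars false

/-! ### Hadamard's lemma in a vector space. -/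

section ParametricIntegral

/-- The integral over `[0, 1]` of a smooth function depending smoothly on a parameter is a smooth
function of the parameter. -/
theorem contDiff_integral_zero_one {P : Type*} [NormedAddCommGroup P] [NormedSpace ℝ P]
    {G : P × ℝ → ℝ} (hG : ContDiff ℝ ∞ G) :
    ContDiff ℝ ∞ (fun p ↦ ∫ t in (0 : ℝ)..1, G (p, t)) := by
  -- The integral is the convolution of the indicator `f` with `g p`, evaluated at 0; this is why
  -- `g` contains the reflection `-u`. The cutoff `ψ` provides compact support in `u`, and equals 1
  -- on [-2, 2], hence at all the points `-t` that contribute.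
  let ψ : ContDiffBump (0 : ℝ) := ⟨2, 3, by norm_num, by norm_num⟩
  let f : ℝ → ℝ := (Set.Ioc (0 : ℝ) 1).indicator 1
  let g : P → ℝ → ℝ := fun p u ↦ ψ u * G (p, -u)
  have hf : MeasureTheory.LocallyIntegrable f MeasureTheory.volume := by
    refine MeasureTheory.Integrable.locallyIntegrable ?_
    rw [MeasureTheory.integrable_indicator_iff measurableSet_Ioc]
    exact MeasureTheory.integrableOn_const (by simp)
  have hg : ContDiffOn ℝ ∞ ↿g (Set.univ ×ˢ Set.univ) := by
    refine ContDiff.contDiffOn ?_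
    exact (ψ.contDiff.comp contDiff_snd).mul (hG.comp (contDiff_fst.prodMk contDiff_snd.neg))
  have hgs : ∀ p, ∀ u, p ∈ (Set.univ : Set P) → u ∉ tsupport ψ → g p u = 0 := by
    intro p u _ hu
    simp [g, image_eq_zero_of_notMem_tsupport hu]
  have key := MeasureTheory.contDiffOn_convolution_right_with_param_comp (μ := MeasureTheory.volume)
    (n := ⊤) (ContinuousLinearMap.mul ℝ ℝ) (v := fun _ : P ↦ (0 : ℝ)) (s := Set.univ)
    contDiffOn_const isOpen_univ ψ.hasCompactSupport hgs hf hg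
  rw [contDiffOn_univ] at key
  convert key using 2 with p
  rw [intervalIntegral.integral_of_le zero_le_one,
    ← MeasureTheory.integral_indicator measurableSet_Ioc]
  unfold MeasureTheory.convolution
  refine MeasureTheory.integral_congr_ae (Filter.Eventually.of_forall fun t ↦ ?_)
  by_cases ht : t ∈ Set.Ioc (0 : ℝ) 1
  · have hψ : ψ (-t) = 1 := ψ.one_of_mem_closedBall (by
      simp only [Metric.mem_closedBall, dist_zero_right, norm_neg, Real.norm_eq_abs, ψ]
      rw [abs_of_pos ht.1]; linarith [ht.2])
    simp [f, g, ht, hψ]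
  · simp [f, ht]

/-- **Hadamard's lemma**: a smooth function on a finite-dimensional space is the sum of its value
at a point and of products of the coordinates centred at that point with smooth functions. -/
theorem exists_hadamard {E : Type*} [NormedAddCommGroup E] [NormedSpace ℝ E] {ι : Type*}
    [Fintype ι] (b : Module.Basis ι ℝ E) {f : E → ℝ} (hf : ContDiff ℝ ∞ f) (a : E) :
    ∃ g : ι → E → ℝ, (∀ i, ContDiff ℝ ∞ (g i)) ∧
      ∀ y, f y = f a + ∑ i, b.coord i (y - a) * g i y := by
  have hsm : ∀ v : E, ContDiff ℝ ∞ (fun p : E × ℝ ↦ fderiv ℝ f (a + p.2 • (p.1 - a)) v) := by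
    intro v
    have h1 : ContDiff ℝ ∞ (fderiv ℝ f) := hf.fderiv_right (by simp)
    exact (h1.comp (contDiff_const.add
      (contDiff_snd.smul (contDiff_fst.sub contDiff_const)))).clm_apply contDiff_const
  -- The fundamental theorem of calculus along the segment from `a` to `y`, with `y - a` expanded in
  -- the basis.
  refine ⟨fun i y ↦ ∫ t in (0 : ℝ)..1, fderiv ℝ f (a + t • (y - a)) (b i),
    fun i ↦ contDiff_integral_zero_one (hsm (b i)), fun y ↦ ?_⟩
  have hd : ∀ t : ℝ, HasDerivAt (fun t : ℝ ↦ f (a + t • (y - a)))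
      (fderiv ℝ f (a + t • (y - a)) (y - a)) t := by
    intro t
    have h1 : HasDerivAt (fun t : ℝ ↦ a + t • (y - a)) (y - a) t := by
      simpa using ((hasDerivAt_id t).smul_const (y - a)).const_add a
    exact ((hf.differentiable (by simp)) _).hasFDerivAt.comp_hasDerivAt t h1
  have hc : ∀ v : E, Continuous (fun t : ℝ ↦ fderiv ℝ f (a + t • (y - a)) v) := fun v ↦
    (hsm v).continuous.comp (Continuous.prodMk_right y)
  have hint := intervalIntegral.integral_eq_sub_of_hasDerivAt (a := 0) (b := 1)
    (fun t _ ↦ hd t) ((hc (y - a)).intervalIntegrable 0 1)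
  simp only [one_smul, add_sub_cancel, zero_smul, add_zero] at hint
  have hsum : ∀ t : ℝ, fderiv ℝ f (a + t • (y - a)) (y - a)
      = ∑ i, b.coord i (y - a) * fderiv ℝ f (a + t • (y - a)) (b i) := by
    intro t
    conv_lhs => rw [← b.sum_repr (y - a)]
    simp only [map_sum, map_smul, smul_eq_mul, Module.Basis.coord_apply]
    rw [b.sum_repr]
  have : f y - f a = ∑ i, b.coord i (y - a) *
      ∫ t in (0 : ℝ)..1, fderiv ℝ f (a + t • (y - a)) (b i) := by
    rw [← hint]
    simp_rw [hsum, ← intervalIntegral.integral_const_mul]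
    rw [intervalIntegral.integral_finsetSum]
    exact fun i _ ↦ ((hc (b i)).const_mul _).intervalIntegrable 0 1
  rw [← this]; ring

end ParametricIntegral

/-! ### Global extensions of local objects, coordinates and dual bases. -/

section LocalExtension

variable {E : Type*} [NormedAddCommGroup E] [NormedSpace ℝ E] [FiniteDimensional ℝ E]
  {M : Type*} [TopologicalSpace M] [ChartedSpace E M] [IsManifold 𝓘(ℝ, E) ∞ M]
  {F : Type*} [NormedAddCommGroup F] [NormedSpace ℝ F]
  {V : M → Type*} [TopologicalSpace (TotalSpace F V)]
  [∀ x, AddCommGroup (V x)] [∀ x, Module ℝ (V x)] [∀ x, TopologicalSpace (V x)]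
  [FiberBundle F V] [VectorBundle ℝ F V]

theorem exists_contMDiffMap_eventuallyEq_one [T2Space M] {x : M} {U : Set M} (hU : U ∈ 𝓝 x) :
    ∃ χ : C^∞⟮𝓘(ℝ, E), M; 𝓘(ℝ, ℝ), ℝ⟯, (∀ᶠ y in 𝓝 x, χ y = 1) ∧ tsupport χ ⊆ U := by
  obtain ⟨χ, -, hχ⟩ := (SmoothBumpFunction.nhds_basis_tsupport (I := 𝓘(ℝ, E)) x).mem_iff.1 hU
  exact ⟨⟨χ, χ.contMDiff⟩, χ.eventuallyEq_one, hχ⟩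

/-- A section that is smooth near a point agrees near that point with a global smooth section. -/
theorem exists_section_eventuallyEq [T2Space M] {x : M} {U : Set M} (hU : U ∈ 𝓝 x)
    {s : Π y : M, V y} (hs : ContMDiffOn 𝓘(ℝ, E) (𝓘(ℝ, E).prod 𝓘(ℝ, F)) ∞
      (fun y ↦ TotalSpace.mk' F y (s y)) U) :
    ∃ S : Sections E F V, ∀ᶠ y in 𝓝 x, S y = s y := by
  obtain ⟨χ, h1, h2⟩ := exists_contMDiffMap_eventuallyEq_one (E := E) (interior_mem_nhds.2 hU)
  refine ⟨⟨fun y ↦ χ y • s y, ?_⟩, ?_⟩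
  · exact ContMDiffOn.smul_section_of_tsupport (u := interior U) χ.contMDiff.contMDiffOn
      isOpen_interior h2 (hs.mono interior_subset)
  · filter_upwards [h1] with y hy
    simp [hy]

/-- A function that is smooth near a point agrees near that point with a global smooth function. -/
theorem exists_contMDiffMap_eventuallyEq [T2Space M] {x : M} {U : Set M} (hU : U ∈ 𝓝 x)
    {f : M → ℝ} (hf : ContMDiffOn 𝓘(ℝ, E) 𝓘(ℝ, ℝ) ∞ f U) :
    ∃ g : C^∞⟮𝓘(ℝ, E), M; 𝓘(ℝ, ℝ), ℝ⟯, ∀ᶠ y in 𝓝 x, g y = f y := by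
  obtain ⟨χ, h1, h2⟩ := exists_contMDiffMap_eventuallyEq_one (E := E) (interior_mem_nhds.2 hU)
  refine ⟨⟨fun y ↦ χ y • f y, contMDiff_of_tsupport fun y hy ↦ ?_⟩, ?_⟩
  · have hy' : y ∈ interior U := h2 (tsupport_smul_subset_left _ _ hy)
    exact χ.contMDiff.contMDiffAt.smul (hf.contMDiffAt (mem_interior_iff_mem_nhds.1 hy'))
  · filter_upwards [h1] with y hy
    simp [hy]

theorem exists_section_eventuallyEq_extend [T2Space M] [ContMDiffVectorBundle ∞ F V 𝓘(ℝ, E)]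
    {x : M} (v : V x) :
    ∃ S : Sections E F V, ∀ᶠ y in 𝓝 x, S y = FiberBundle.extend F v y := by
  obtain ⟨U, hU, hs⟩ := FiberBundle.exists_contMDiffOn_extend (k := ∞) 𝓘(ℝ, E) F v
  exact exists_section_eventuallyEq hU hs

theorem exists_section_apply_eq [T2Space M] [ContMDiffVectorBundle ∞ F V 𝓘(ℝ, E)]
    {x : M} (v : V x) : ∃ S : Sections E F V, S x = v := by
  obtain ⟨S, hS⟩ := exists_section_eventuallyEq_extend (E := E) (F := F) v
  exact ⟨S, by simpa using hS.self_of_nhds⟩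

/-- Near every point there are functions `uᵢ` and vector fields `Xⱼ`, defined globally, with
`duᵢ(Xⱼ) = δᵢⱼ`, and Hadamard's lemma holds in the coordinates `uᵢ`. -/
theorem exists_coordinates [T2Space M] (x₀ : M) :
    ∃ (u : Fin (Module.finrank ℝ E) → C^∞⟮𝓘(ℝ, E), M; 𝓘(ℝ, ℝ), ℝ⟯)
      (X : Fin (Module.finrank ℝ E) → VectorFields E M),
      (∀ᶠ x in 𝓝 x₀, ∀ i j, mvfderiv 𝓘(ℝ, E) (u i) x (X j x) = if i = j then 1 else 0) ∧
      ∀ f : C^∞⟮𝓘(ℝ, E), M; 𝓘(ℝ, ℝ), ℝ⟯,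
        ∃ g : Fin (Module.finrank ℝ E) → C^∞⟮𝓘(ℝ, E), M; 𝓘(ℝ, ℝ), ℝ⟯,
          ∀ᶠ x in 𝓝 x₀, f x = f x₀ + ∑ i, (u i x - u i x₀) * g i x := by
  let b := Module.finBasis ℝ E
  let t := trivializationAt E (fun x : M ↦ TangentSpace 𝓘(ℝ, E) x) x₀
  let φ : M → E := extChartAt 𝓘(ℝ, E) x₀
  have hsrc : (chartAt E x₀).source ∈ 𝓝 x₀ := chart_source_mem_nhds E x₀
  have hφ : ContMDiffOn 𝓘(ℝ, E) 𝓘(ℝ, E) ∞ φ (chartAt E x₀).source := contMDiffOn_extChartAt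
  have hcoord : ∀ i, ContDiff ℝ (∞ : ℕ∞ω) (fun y : E ↦ b.coord i y) := fun i ↦
    (LinearMap.toContinuousLinearMap (b.coord i)).contDiff
  have hu : ∀ i, ∃ u : C^∞⟮𝓘(ℝ, E), M; 𝓘(ℝ, ℝ), ℝ⟯, ∀ᶠ x in 𝓝 x₀, u x = b.coord i (φ x) :=
    fun i ↦ exists_contMDiffMap_eventuallyEq hsrc ((hcoord i).contMDiff.comp_contMDiffOn hφ)
  have hX : ∀ j, ∃ X : VectorFields E M, ∀ᶠ x in 𝓝 x₀, X x = t.localFrame b j x := fun j ↦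
    exists_section_eventuallyEq
      (t.open_baseSet.mem_nhds (FiberBundle.mem_baseSet_trivializationAt' x₀))
      (t.contMDiffOn_localFrame_baseSet ∞ b j)
  choose u hu using hu
  choose X hX using hX
  refine ⟨u, X, ?_, fun f ↦ ?_⟩
  · have h1 := Filter.eventually_all.2 fun i ↦ (hu i).eventually_nhds
    filter_upwards [h1, Filter.eventually_all.2 hX, hsrc] with x hux hXx hx i j
    have hxb : x ∈ t.baseSet := by simpa [t] using hx
    have hφx : MDifferentiableAt 𝓘(ℝ, E) 𝓘(ℝ, E) φ x :=
      ((hφ.contMDiffAt ((chartAt E x₀).open_source.mem_nhds hx)).mdifferentiableAt (by simp))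
    -- On the chart domain the derivative of the chart is the trivialization of the tangent bundle,
    -- so it sends the local frame to the constant basis `b`.
    have e1 : mfderiv 𝓘(ℝ, E) 𝓘(ℝ, E) φ x (X j x) = b j := by
      rw [← TangentBundle.continuousLinearMapAt_trivializationAt hx, hXx,
        t.localFrame_apply_of_mem_baseSet b hxb]
      have : t.continuousLinearMapAt ℝ x (t.symmL ℝ x (b j)) = b j :=
        t.continuousLinearMapAt_symmL hxb _
      have hb : t.basisAt b hxb j = t.symmL ℝ x (b j) := by
        rw [Trivialization.basisAt, Module.Basis.map_apply, LinearEquiv.symm_apply_eq,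
          Trivialization.linearEquivAt_apply, Trivialization.symmL_apply _ hxb, t.mk_symm hxb,
          t.apply_symm_apply' hxb]
      rw [hb]
      exact this
    have e2 : HasMFDerivAt 𝓘(ℝ, E) 𝓘(ℝ, ℝ) (u i) x
        ((LinearMap.toContinuousLinearMap (b.coord i)).comp
          (mfderiv 𝓘(ℝ, E) 𝓘(ℝ, E) φ x)) := by
      refine HasMFDerivAt.congr_of_eventuallyEq ?_ (hux i)
      exact (LinearMap.toContinuousLinearMap (b.coord i)).hasMFDerivAt.comp x hφx.hasMFDerivAt
    have e3 : mvfderiv 𝓘(ℝ, E) (u i) x (X j x) = b.coord i (b j) := by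
      rw [← e1]
      exact congr($(e2.mfderiv) (X j x))
    rw [e3, b.coord_apply, b.repr_self, Finsupp.single_apply]
    simp [eq_comm]
  · have hsm : ContMDiffOn 𝓘(ℝ, E) 𝓘(ℝ, ℝ) ∞ (fun y ↦ f ((extChartAt 𝓘(ℝ, E) x₀).symm y))
        (extChartAt 𝓘(ℝ, E) x₀).target :=
      f.contMDiff.comp_contMDiffOn (contMDiffOn_extChartAt_symm x₀)
    -- `exists_hadamard` requires a function smooth on all of `E`; `f` read in the chart is replaced
    -- by a global function with the same germ.
    obtain ⟨f', hf'⟩ := exists_contMDiffMap_eventuallyEq (x := φ x₀)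
      (extChartAt_target_mem_nhds (I := 𝓘(ℝ, E)) x₀) hsm
    obtain ⟨g, hg, hfg⟩ := exists_hadamard b f'.contMDiff.contDiff (φ x₀)
    have hG : ∀ i, ∃ G : C^∞⟮𝓘(ℝ, E), M; 𝓘(ℝ, ℝ), ℝ⟯, ∀ᶠ x in 𝓝 x₀, G x = g i (φ x) :=
      fun i ↦ exists_contMDiffMap_eventuallyEq hsrc ((hg i).contMDiff.comp_contMDiffOn hφ)
    choose G hG using hG
    refine ⟨G, ?_⟩
    have hφ0 : Filter.Tendsto φ (𝓝 x₀) (𝓝 (φ x₀)) := continuousAt_extChartAt x₀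
    have hff : ∀ᶠ x in 𝓝 x₀, f' (φ x) = f x := by
      filter_upwards [hφ0.eventually hf', hsrc] with x hx hxs
      rw [hx]
      exact congrArg f ((extChartAt 𝓘(ℝ, E) x₀).left_inv (by simpa using hxs))
    filter_upwards [hff, Filter.eventually_all.2 hu, Filter.eventually_all.2 hG] with x h1 h2 h3
    rw [← h1, hfg, hff.self_of_nhds]
    simp [h2, h3, (hu _).self_of_nhds]

theorem mvfderiv_congr_of_eventually_eq {f g : M → F} {x : M} (h : ∀ᶠ y in 𝓝 x, f y = g y) :
    mvfderiv 𝓘(ℝ, E) f x = mvfderiv 𝓘(ℝ, E) g x := by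
  have h' : f =ᶠ[𝓝 x] g := h
  ext v
  simp only [mvfderiv, h'.mfderiv_eq]
  rfl

theorem coframe_apply_frame (x : M) (i j : Fin (Module.finrank ℝ E)) :
    coframe (E := E) x i (frame x j) = if i = j then 1 else 0 := by
  change (frame (E := E) x).coord i (frame x j) = _
  rw [Module.Basis.coord_apply, Module.Basis.repr_self, Finsupp.single_apply]
  simp [eq_comm]

theorem sum_coframe_smul_frame (x : M) (v : TangentSpace 𝓘(ℝ, E) x) :
    ∑ i, coframe x i v • frame (E := E) x i = v :=
  (frame (E := E) x).sum_repr v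

/-- Expansion of a covector in a basis dual to a family of vectors. -/
theorem sum_smul_eq_of_dual {x : M} {η : Fin (Module.finrank ℝ E) → Cotangent E x}
    {X : Fin (Module.finrank ℝ E) → TangentSpace 𝓘(ℝ, E) x}
    (h : ∀ i j, η i (X j) = if i = j then 1 else 0) (θ : Cotangent E x) :
    ∑ i, θ (X i) • η i = θ := by
  have : FiniteDimensional ℝ (TangentSpace 𝓘(ℝ, E) x) := inferInstanceAs (FiniteDimensional ℝ E)
  have hX : LinearIndependent ℝ X := by
    rw [Fintype.linearIndependent_iff]
    intro c hc i
    have := congrArg (η i) hc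
    simpa [h] using this
  let b := basisOfLinearIndependentOfCardEqFinrank' X hX (by simp; rfl)
  refine ContinuousLinearMap.coe_injective (b.ext fun j ↦ ?_)
  simp [b, h]

/-- Contraction of a covector slot with a vector slot does not depend on the pair of dual bases. -/
theorem sum_coframe_frame_eq {W : Type*} [AddCommGroup W] [Module ℝ W] {x : M}
    (Φ : Cotangent E x →ₗ[ℝ] TangentSpace 𝓘(ℝ, E) x →ₗ[ℝ] W)
    {η : Fin (Module.finrank ℝ E) → Cotangent E x}
    {X : Fin (Module.finrank ℝ E) → TangentSpace 𝓘(ℝ, E) x}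
    (h : ∀ i j, η i (X j) = if i = j then 1 else 0) :
    ∑ i, Φ (coframe x i) (frame x i) = ∑ i, Φ (η i) (X i) := by
  have h1 : ∀ i, Φ (coframe x i) (frame x i) =
      ∑ k, coframe x i (X k) • Φ (η k) (frame x i) := by
    intro i
    conv_lhs => rw [← sum_smul_eq_of_dual h (coframe x i)]
    simp
  have h2 : ∀ k, Φ (η k) (X k) = ∑ i, coframe x i (X k) • Φ (η k) (frame x i) := by
    intro k
    conv_lhs => rw [← sum_coframe_smul_frame x (X k)]
    simp
  simp_rw [h1, h2]
  exact Finset.sum_comm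

end LocalExtension

/-! ### Smoothness of vector-bundle-valued 1-forms. -/

section HomSections

variable {E : Type*} [NormedAddCommGroup E] [NormedSpace ℝ E] [FiniteDimensional ℝ E]
  {M : Type*} [TopologicalSpace M] [ChartedSpace E M] [IsManifold 𝓘(ℝ, E) ∞ M]
  {F : Type*} [NormedAddCommGroup F] [NormedSpace ℝ F]
  {V : M → Type*} [TopologicalSpace (TotalSpace F V)]
  [∀ x, AddCommGroup (V x)] [∀ x, Module ℝ (V x)] [∀ x, TopologicalSpace (V x)]
  [FiberBundle F V] [VectorBundle ℝ F V]
  [∀ x, IsTopologicalAddGroup (V x)] [∀ x, ContinuousSMul ℝ (V x)]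

/-- A family of linear maps `TₓM → Vₓ` is smooth if its values on global vector fields are. -/
theorem contMDiffAt_hom_of_forall_vectorField [T2Space M]
    {φ : Π x : M, TangentSpace 𝓘(ℝ, E) x →L[ℝ] V x}
    {x₀ : M} (h : ∀ X : VectorFields E M, ContMDiffAt 𝓘(ℝ, E) (𝓘(ℝ, E).prod 𝓘(ℝ, F)) ∞
      (fun x ↦ TotalSpace.mk' F x (φ x (X x))) x₀) :
    ContMDiffAt 𝓘(ℝ, E) (𝓘(ℝ, E).prod 𝓘(ℝ, E →L[ℝ] F)) ∞
      (fun x ↦ TotalSpace.mk' (E →L[ℝ] F) (E := fun x : M ↦ TangentSpace 𝓘(ℝ, E) x →L[ℝ] V x)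
        x (φ x)) x₀ := by
  rw [contMDiffAt_hom_bundle]
  refine ⟨contMDiffAt_id, ?_⟩
  let b := Module.finBasis ℝ E
  let t := trivializationAt E (fun x : M ↦ TangentSpace 𝓘(ℝ, E) x) x₀
  let e := trivializationAt F V x₀
  have hX : ∀ j, ∃ X : VectorFields E M, ∀ᶠ x in 𝓝 x₀, X x = t.localFrame b j x := fun j ↦
    exists_section_eventuallyEq
      (t.open_baseSet.mem_nhds (FiberBundle.mem_baseSet_trivializationAt' x₀))
      (t.contMDiffOn_localFrame_baseSet ∞ b j)
  choose X hX using hX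
  have hs : ∀ j, ContMDiffAt 𝓘(ℝ, E) 𝓘(ℝ, F) ∞ (fun x ↦ (e ⟨x, φ x (X j x)⟩).2) x₀ := fun j ↦
    (contMDiffAt_section _).1 (h (X j))
  -- In the trivializations φ is the sum of the bʲ ⊗ φ(Xⱼ), with bʲ the constant dual basis, so only
  -- the smoothness of each φ(Xⱼ) matters.
  have hsum : ContMDiffAt 𝓘(ℝ, E) 𝓘(ℝ, E →L[ℝ] F) ∞ (fun x ↦ ∑ j,
      ContinuousLinearMap.smulRightL ℝ E F (LinearMap.toContinuousLinearMap (b.coord j))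
        (e ⟨x, φ x (X j x)⟩).2) x₀ := by
    refine contMDiffAt_finsetSum fun j _ ↦ ?_
    exact (ContinuousLinearMap.contMDiff _).contMDiffAt.comp x₀ (hs j)
  refine hsum.congr_of_eventuallyEq ?_
  filter_upwards [Filter.eventually_all.2 hX,
    t.open_baseSet.mem_nhds (FiberBundle.mem_baseSet_trivializationAt' x₀),
    e.open_baseSet.mem_nhds (FiberBundle.mem_baseSet_trivializationAt' x₀)] with x hx hxt hxe
  refine ContinuousLinearMap.coe_injective (b.ext fun k ↦ ?_)
  have hk : X k x = t.symmL ℝ x (b k) := by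
    rw [hx, t.localFrame_apply_of_mem_baseSet b hxt, Trivialization.basisAt, Module.Basis.map_apply,
      LinearEquiv.symm_apply_eq, Trivialization.linearEquivAt_apply,
      Trivialization.symmL_apply _ hxt, t.mk_symm hxt, t.apply_symm_apply' hxt]
  have h1 : ContinuousLinearMap.inCoordinates E (fun x : M ↦ TangentSpace 𝓘(ℝ, E) x) F V x₀ x x₀ x
      (φ x) (b k) = (e ⟨x, φ x (X k x)⟩).2 := by
    rw [ContinuousLinearMap.inCoordinates_eq hxt hxe, hk]
    simp [e, t]
    rw [Trivialization.symmL_apply _ hxt]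
  refine h1.trans ?_
  simp [Finsupp.single_apply]

theorem contMDiff_hom_of_forall_vectorField [T2Space M]
    {φ : Π x : M, TangentSpace 𝓘(ℝ, E) x →L[ℝ] V x}
    (h : ∀ X : VectorFields E M, IsSmoothSection E F V (fun x ↦ φ x (X x))) :
    ContMDiff 𝓘(ℝ, E) (𝓘(ℝ, E).prod 𝓘(ℝ, E →L[ℝ] F)) ∞
      (fun x ↦ TotalSpace.mk' (E →L[ℝ] F) (E := fun x : M ↦ TangentSpace 𝓘(ℝ, E) x →L[ℝ] V x)
        x (φ x)) :=
  fun _ ↦ contMDiffAt_hom_of_forall_vectorField fun X ↦ (h X).contMDiffAt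

theorem contMDiff_mvfderiv_apply (f : C^∞⟮𝓘(ℝ, E), M; 𝓘(ℝ, ℝ), ℝ⟯) (X : VectorFields E M) :
    ContMDiff 𝓘(ℝ, E) 𝓘(ℝ, ℝ) ∞ (fun x ↦ mvfderiv 𝓘(ℝ, E) f x (X x)) := by
  have h1 := (f.contMDiff.contMDiff_tangentMap (m := ∞) (by simp)).comp X.contMDiff
  exact (contMDiff_snd_tangentBundle_modelSpace ℝ 𝓘(ℝ, ℝ)).comp h1

/-- The differential of a smooth function, as a `1`-form. -/
noncomputable def differential [T2Space M] (f : C^∞⟮𝓘(ℝ, E), M; 𝓘(ℝ, ℝ), ℝ⟯) : OneForms E M :=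
  ⟨fun x ↦ mvfderiv 𝓘(ℝ, E) f x, by
    refine contMDiff_hom_of_forall_vectorField (F := ℝ) (V := fun _ : M ↦ ℝ) fun X x ↦ ?_
    exact (contMDiffAt_section _).2 (contMDiff_mvfderiv_apply f X x)⟩

end HomSections

/-! ### Existence of smooth connections. -/

section ExistenceOfConnections

variable {E : Type*} [NormedAddCommGroup E] [NormedSpace ℝ E] [FiniteDimensional ℝ E]
  {M : Type*} [TopologicalSpace M] [ChartedSpace E M] [IsManifold 𝓘(ℝ, E) ∞ M]
  {F : Type*} [NormedAddCommGroup F] [NormedSpace ℝ F]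
  {V : M → Type*} [TopologicalSpace (TotalSpace F V)]
  [∀ x, AddCommGroup (V x)] [∀ x, Module ℝ (V x)] [∀ x, TopologicalSpace (V x)]
  [FiberBundle F V] [VectorBundle ℝ F V]
  [∀ x, IsTopologicalAddGroup (V x)] [∀ x, ContinuousSMul ℝ (V x)]

theorem contMDiffOn_mvfderiv_apply {f : M → F} {U : Set M} (hU : IsOpen U)
    (hf : ContMDiffOn 𝓘(ℝ, E) 𝓘(ℝ, F) ∞ f U) (X : VectorFields E M) :
    ContMDiffOn 𝓘(ℝ, E) 𝓘(ℝ, F) ∞ (fun x ↦ mvfderiv 𝓘(ℝ, E) f x (X x)) U := by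
  have h1 := (hf.contMDiffOn_tangentMapWithin (m := ∞) (by simp) hU.uniqueMDiffOn).comp
    (X.contMDiff.contMDiffOn (s := U)) (fun x hx ↦ hx)
  refine ((contMDiff_snd_tangentBundle_modelSpace F 𝓘(ℝ, F)).comp_contMDiffOn h1).congr ?_
  intro x hx
  change mvfderiv 𝓘(ℝ, E) f x (X x) = mfderivWithin 𝓘(ℝ, E) 𝓘(ℝ, F) f U x (X x)
  rw [mfderivWithin_of_isOpen hU hx]
  rfl

/-- The flat covariant derivative given by a local trivialization. -/
noncomputable def trivializationDeriv (e : Trivialization F (TotalSpace.proj : TotalSpace F V → M))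
    [e.IsLinear ℝ] (s : Π x : M, V x) (x : M) : TangentSpace 𝓘(ℝ, E) x →L[ℝ] V x :=
  (e.symmL ℝ x).comp (mvfderiv 𝓘(ℝ, E) (fun y ↦ (e ⟨y, s y⟩).2) x)

variable [ContMDiffVectorBundle ∞ F V 𝓘(ℝ, E)]

theorem isCovariantDerivativeOn_trivializationDeriv
    (e : Trivialization F (TotalSpace.proj : TotalSpace F V → M)) [MemTrivializationAtlas e] :
    IsCovariantDerivativeOn F (trivializationDeriv (E := E) e) e.baseSet where
  add {s s' x} hs hs' hx := by
    have : ContMDiffVectorBundle 1 F V 𝓘(ℝ, E) := .of_le (n := ∞) (by simp)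
    have h1 := (e.mdifferentiableAt_section_iff 𝓘(ℝ, E) s hx).1 hs
    have h2 := (e.mdifferentiableAt_section_iff 𝓘(ℝ, E) s' hx).1 hs'
    have h3 : mvfderiv 𝓘(ℝ, E) (fun y ↦ (e ⟨y, (s + s') y⟩).2) x =
        mvfderiv 𝓘(ℝ, E) (fun y ↦ (e ⟨y, s y⟩).2) x +
          mvfderiv 𝓘(ℝ, E) (fun y ↦ (e ⟨y, s' y⟩).2) x := by
      rw [← mvfderiv_add h1 h2]
      refine mvfderiv_congr_of_eventually_eq ?_
      filter_upwards [e.open_baseSet.mem_nhds hx] with y hy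
      exact (e.linear ℝ hy).map_add _ _
    ext v
    simp only [trivializationDeriv, h3, ContinuousLinearMap.comp_add,
      add_apply]
  leibniz {s g x} hs hg hx := by
    have : ContMDiffVectorBundle 1 F V 𝓘(ℝ, E) := .of_le (n := ∞) (by simp)
    have h1 := (e.mdifferentiableAt_section_iff 𝓘(ℝ, E) s hx).1 hs
    have h3 : mvfderiv 𝓘(ℝ, E) (fun y ↦ (e ⟨y, (g • s) y⟩).2) x =
        g x • mvfderiv 𝓘(ℝ, E) (fun y ↦ (e ⟨y, s y⟩).2) x +
          (mvfderiv 𝓘(ℝ, E) g x).smulRight (e ⟨x, s x⟩).2 := by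
      rw [← mvfderiv_smul hg h1]
      refine mvfderiv_congr_of_eventually_eq ?_
      filter_upwards [e.open_baseSet.mem_nhds hx] with y hy
      exact (e.linear ℝ hy).map_smul _ _
    ext v
    have h4 : e.symmL ℝ x (e ⟨x, s x⟩).2 = s x := by
      rw [e.symmL_apply hx, e.symm_apply_apply_mk hx]
    simp only [trivializationDeriv, h3, ContinuousLinearMap.comp_add, ContinuousLinearMap.comp_smul,
      add_apply, smul_apply, ContinuousLinearMap.comp_apply,
      ContinuousLinearMap.smulRight_apply, map_smul, h4]

theorem contMDiffOn_trivializationDeriv [T2Space M]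
    (e : Trivialization F (TotalSpace.proj : TotalSpace F V → M)) [MemTrivializationAtlas e]
    (s : Sections E F V) :
    ContMDiffOn 𝓘(ℝ, E) (𝓘(ℝ, E).prod 𝓘(ℝ, E →L[ℝ] F)) ∞
      (fun x ↦ TotalSpace.mk' (E →L[ℝ] F) (E := fun x : M ↦ TangentSpace 𝓘(ℝ, E) x →L[ℝ] V x)
        x (trivializationDeriv (E := E) e s x)) e.baseSet := by
  intro x hx
  refine (contMDiffAt_hom_of_forall_vectorField fun X ↦ ?_).contMDiffWithinAt
  have h1 : ContMDiffOn 𝓘(ℝ, E) 𝓘(ℝ, F) ∞ (fun y ↦ (e ⟨y, s y⟩).2) e.baseSet :=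
    e.contMDiffOn_section_baseSet_iff.1 s.contMDiff.contMDiffOn
  have h2 := (contMDiffOn_mvfderiv_apply e.open_baseSet h1 X).contMDiffAt
    (e.open_baseSet.mem_nhds hx)
  exact (e.contMDiffAt_symmL (n := ∞) (IB := 𝓘(ℝ, E)) hx).clm_bundle_apply
    (E₁ := fun _ : M ↦ F) ((contMDiffAt_section _).2 h2)

/-- Every smooth vector bundle admits a smooth connection. -/
theorem exists_contMDiffCovariantDerivative [T2Space M] [SigmaCompactSpace M] :
    ∃ D : CovariantDerivative 𝓘(ℝ, E) F V,
      CovariantDerivative.ContMDiffCovariantDerivative D ∞ := by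
  obtain ⟨ρ, hρ⟩ := SmoothPartitionOfUnity.exists_isSubordinate 𝓘(ℝ, E) (s := Set.univ)
    isClosed_univ (fun i : M ↦ (trivializationAt F V i).baseSet)
    (fun i ↦ (trivializationAt F V i).open_baseSet)
    (fun i _ ↦ Set.mem_iUnion.2 ⟨i, FiberBundle.mem_baseSet_trivializationAt' i⟩)
  let d : M → (Π x : M, V x) → (Π x : M, TangentSpace 𝓘(ℝ, E) x →L[ℝ] V x) :=
    fun i ↦ trivializationDeriv (trivializationAt F V i)
  let D : (Π x : M, V x) → (Π x : M, TangentSpace 𝓘(ℝ, E) x →L[ℝ] V x) :=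
    fun s x ↦ ∑ᶠ i, ρ i x • d i s x
  -- The axioms of a covariant derivative are conditions at one point, and the weights ρᵢ are never
  -- differentiated. At `x` they may thus be frozen at their values there, which leaves a finite
  -- combination with constant weights of sum 1.
  have key : ∀ x, ∃ D' : (Π x : M, V x) → (Π x : M, TangentSpace 𝓘(ℝ, E) x →L[ℝ] V x),
      IsCovariantDerivativeOn F D' {x} ∧ ∀ s, D s x = D' s x := by
    intro x
    let T := ρ.finsupport x
    have hT : ∀ i, i ∈ T ↔ ρ i x ≠ 0 := fun i ↦ by simp [T, SmoothPartitionOfUnity.mem_finsupport]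
    refine ⟨fun s y ↦ ∑ i : T, (fun _ ↦ ρ i x : M → ℝ) y • d i s y, ?_, fun s ↦ ?_⟩
    · refine IsCovariantDerivativeOn.finite_affine_combination (s := Finset.univ)
        (f := fun (i : T) _ ↦ ρ i x) (cov := fun i : T ↦ d i) (fun i ↦ ?_) ?_
      · refine (isCovariantDerivativeOn_trivializationDeriv _).mono ?_
        rintro _ rfl
        exact hρ i (subset_tsupport _ ((hT i).1 i.2))
      · ext y
        simp only [Finset.sum_apply, Pi.one_apply]
        rw [Finset.sum_coe_sort T (fun i ↦ ρ i x)]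
        exact ρ.sum_finsupport x (Set.mem_univ x)
    · change ∑ᶠ i, ρ i x • d i s x = ∑ i : T, ρ i x • d i s x
      rw [Finset.sum_coe_sort T (fun i ↦ ρ i x • d i s x)]
      refine finsum_eq_sum_of_support_subset _ fun i hi ↦ ?_
      exact (hT i).2 (left_ne_zero_of_smul hi)
  refine ⟨⟨D, ⟨fun {s s' x} hs hs' _ ↦ ?_, fun {s g x} hs hg _ ↦ ?_⟩⟩, ⟨⟨fun {s} hs ↦ ?_⟩⟩⟩
  · obtain ⟨D', hD', h⟩ := key x
    rw [h, h, h, hD'.add hs hs' rfl]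
  · obtain ⟨D', hD', h⟩ := key x
    rw [h, h, hD'.leibniz hs hg rfl]
  · let S : Sections E F V := ⟨s, by simpa using contMDiffOn_univ.1 hs⟩
    rw [contMDiffOn_univ]
    refine ContMDiff.finsum_section_of_locallyFinite ?_ fun i ↦ ?_
    · exact ρ.locallyFinite.subset fun i x hx ↦ left_ne_zero_of_smul hx
    · exact ContMDiffOn.smul_section_of_tsupport (ρ i).contMDiff.contMDiffOn
        (trivializationAt F V i).open_baseSet (hρ i) (contMDiffOn_trivializationDeriv _ S)

end ExistenceOfConnections

/-! ### Commutators of the quantization with functions. -/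

section Quantization

variable {E : Type*} [NormedAddCommGroup E] [NormedSpace ℝ E] [FiniteDimensional ℝ E]
  {M : Type*} [TopologicalSpace M] [ChartedSpace E M] [IsManifold 𝓘(ℝ, E) ∞ M]
  {F : Type*} [NormedAddCommGroup F] [NormedSpace ℝ F]
  {V : M → Type*} [TopologicalSpace (TotalSpace F V)]
  [∀ x, AddCommGroup (V x)] [∀ x, Module ℝ (V x)] [∀ x, TopologicalSpace (V x)]
  [FiberBundle F V] [VectorBundle ℝ F V]
  [∀ x, IsTopologicalAddGroup (V x)] [∀ x, ContinuousSMul ℝ (V x)]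

theorem IsCovariantDerivativeOn.sum_sections
    {cov : (Π x : M, V x) → (Π x : M, TangentSpace 𝓘(ℝ, E) x →L[ℝ] V x)} {u : Set M}
    (hcov : IsCovariantDerivativeOn F cov u) {ι : Type*} (I : Finset ι) {s : ι → Π x : M, V x} {x : M}
    (hx : x ∈ u)
    (hs : ∀ i ∈ I, MDifferentiableAt 𝓘(ℝ, E) (𝓘(ℝ, E).prod 𝓘(ℝ, F))
      (fun y ↦ TotalSpace.mk' F y (s i y)) x) :
    cov (fun y ↦ ∑ i ∈ I, s i y) x = ∑ i ∈ I, cov (s i) x := by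
  classical
  induction I using Finset.induction_on with
  | empty => simpa using! hcov.zero hx
  | insert a I ha ih =>
    rw [Finset.sum_insert ha, ← ih fun i hi ↦ hs i (Finset.mem_insert_of_mem hi),
      ← hcov.add (hs a (Finset.mem_insert_self a I))
        (.sum_section fun i hi ↦ hs i (Finset.mem_insert_of_mem hi)) hx]
    congr 1
    ext y
    simp [Finset.sum_insert ha]

/-- The extensions of a basis and of its dual basis to local sections remain dual to each other. -/
theorem extend_coframe_apply_extend_frame (x : M) :
    ∀ᶠ y in 𝓝 x, ∀ i j,
      FiberBundle.extend (E := fun x : M ↦ Cotangent E x) (E →L[ℝ] ℝ) (coframe x i) y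
        (FiberBundle.extend E (frame (E := E) x j) y) = if i = j then 1 else 0 := by
  let t := trivializationAt E (fun x : M ↦ TangentSpace 𝓘(ℝ, E) x) x
  let h := trivializationAt (E →L[ℝ] ℝ) (fun x : M ↦ Cotangent E x) x
  have ht : x ∈ t.baseSet := FiberBundle.mem_baseSet_trivializationAt' x
  have hh : x ∈ h.baseSet := FiberBundle.mem_baseSet_trivializationAt' x
  filter_upwards [t.open_baseSet.mem_nhds ht, h.open_baseSet.mem_nhds hh] with y hyt hyh i j
  -- The trivialization of the cotangent bundle is dual to that of the tangent bundle, so sections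
  -- constant in the two have a constant pairing, equal to δᵢⱼ at `x`.
  have h1 : ∀ (z : M), z ∈ t.baseSet → ∀ (θ : Cotangent E z) (w : E),
      (h ⟨z, θ⟩).2 w = θ (t.symm z w) := by
    intro z hz θ w
    rw [hom_trivializationAt_apply]
    simp only
    rw [ContinuousLinearMap.inCoordinates_eq hz (by simp)]
    simp [t]
  have h2 : (h ⟨y, FiberBundle.extend (E := fun x : M ↦ Cotangent E x) (E →L[ℝ] ℝ)
      (coframe x i) y⟩).2 = (h ⟨x, coframe x i⟩).2 := by
    unfold FiberBundle.extend
    rw [h.apply_mk_symm hyh]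
  have h3 := h1 y hyt (FiberBundle.extend (E := fun x : M ↦ Cotangent E x) (E →L[ℝ] ℝ)
      (coframe x i) y) (t ⟨x, frame (E := E) x j⟩).2
  rw [h2, h1 x ht, t.symm_apply_apply_mk ht, coframe_apply_frame] at h3
  exact h3.symm

variable [ContMDiffVectorBundle ∞ F V 𝓘(ℝ, E)]

/-- A smooth connection sends smooth sections to smooth sections. -/
theorem contMDiff_covariantDerivative {D : CovariantDerivative 𝓘(ℝ, E) F V}
    (hD : CovariantDerivative.ContMDiffCovariantDerivative D ∞) (s : Sections E F V) :
    ContMDiff 𝓘(ℝ, E) (𝓘(ℝ, E).prod 𝓘(ℝ, E →L[ℝ] F)) ∞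
      (fun x ↦ TotalSpace.mk' (E →L[ℝ] F) (E := fun x : M ↦ TangentSpace 𝓘(ℝ, E) x →L[ℝ] V x)
        x (D s x)) :=
  contMDiffOn_univ.1 (hD.contMDiff.contMDiff (by simpa using s.contMDiff.contMDiffOn))

theorem covariantDerivative_funSmul (D : CovariantDerivative 𝓘(ℝ, E) F V)
    (f : C^∞⟮𝓘(ℝ, E), M; 𝓘(ℝ, ℝ), ℝ⟯) (s : Sections E F V) (x : M) :
    D (funSmul f s) x = f x • D s x + (mvfderiv 𝓘(ℝ, E) f x).smulRight (s x) :=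
  D.isCovariantDerivativeOnUniv.leibniz s.mdifferentiableAt f.mdifferentiableAt

theorem mdifferentiableAt_mvfderiv_extend [T2Space M] (f : C^∞⟮𝓘(ℝ, E), M; 𝓘(ℝ, ℝ), ℝ⟯) {x : M}
    (v : TangentSpace 𝓘(ℝ, E) x) :
    MDifferentiableAt 𝓘(ℝ, E) 𝓘(ℝ, ℝ)
      (fun y ↦ mvfderiv 𝓘(ℝ, E) f y (FiberBundle.extend E v y)) x := by
  obtain ⟨X, hX⟩ := exists_section_eventuallyEq_extend (E := E) (F := E)
    (V := fun x : M ↦ TangentSpace 𝓘(ℝ, E) x) v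
  refine ((contMDiff_mvfderiv_apply f X).mdifferentiable (by simp) x).congr_of_eventuallyEq ?_
  filter_upwards [hX] with y hy
  rw [hy]

theorem mdifferentiableAt_covariantDerivative_extend [T2Space M]
    {D : CovariantDerivative 𝓘(ℝ, E) F V}
    (hD : CovariantDerivative.ContMDiffCovariantDerivative D ∞) (s : Sections E F V) {x : M}
    (v : TangentSpace 𝓘(ℝ, E) x) :
    MDifferentiableAt 𝓘(ℝ, E) (𝓘(ℝ, E).prod 𝓘(ℝ, F))
      (fun y ↦ TotalSpace.mk' F y (D s y (FiberBundle.extend E v y))) x := by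
  obtain ⟨X, hX⟩ := exists_section_eventuallyEq_extend (E := E) (F := E)
    (V := fun x : M ↦ TangentSpace 𝓘(ℝ, E) x) v
  have h1 := (contMDiff_covariantDerivative hD s).clm_bundle_apply X.contMDiff
  refine (h1.mdifferentiable (by simp) x).congr_of_eventuallyEq ?_
  filter_upwards [hX] with y hy
  rw [hy]

/-- The covariant derivative of a differential, computed from an expansion in a local coframe. -/
theorem covariantDerivative_differential [T2Space M]
    (Dc : CovariantDerivative 𝓘(ℝ, E) (E →L[ℝ] ℝ) (fun x : M ↦ Cotangent E x))
    (f : C^∞⟮𝓘(ℝ, E), M; 𝓘(ℝ, ℝ), ℝ⟯) (x : M) :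
    Dc (differential f) x = ∑ i, (mvfderiv 𝓘(ℝ, E) f x (frame x i) •
        Dc (FiberBundle.extend (E := fun x : M ↦ Cotangent E x) (E →L[ℝ] ℝ) (coframe x i)) x +
      (mvfderiv 𝓘(ℝ, E) (fun y ↦ mvfderiv 𝓘(ℝ, E) f y
        (FiberBundle.extend E (frame (E := E) x i) y)) x).smulRight (coframe x i)) := by
  let h : Fin (Module.finrank ℝ E) → M → ℝ := fun i y ↦
    mvfderiv 𝓘(ℝ, E) f y (FiberBundle.extend E (frame (E := E) x i) y)
  let θ : Fin (Module.finrank ℝ E) → Π y : M, Cotangent E y := fun i ↦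
    FiberBundle.extend (E := fun x : M ↦ Cotangent E x) (E →L[ℝ] ℝ) (coframe x i)
  have hh : ∀ i, MDifferentiableAt 𝓘(ℝ, E) 𝓘(ℝ, ℝ) (h i) x := fun i ↦
    mdifferentiableAt_mvfderiv_extend f _
  have hθ : ∀ i, MDifferentiableAt 𝓘(ℝ, E) (𝓘(ℝ, E).prod 𝓘(ℝ, E →L[ℝ] ℝ))
      (fun y ↦ TotalSpace.mk' (E →L[ℝ] ℝ) (E := fun x : M ↦ Cotangent E x) y (θ i y)) x := fun i ↦
    FiberBundle.mdifferentiableAt_extend 𝓘(ℝ, E) (E →L[ℝ] ℝ) (V := fun x : M ↦ Cotangent E x)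
      (coframe x i)
  have hhθ : ∀ i, MDifferentiableAt 𝓘(ℝ, E) (𝓘(ℝ, E).prod 𝓘(ℝ, E →L[ℝ] ℝ))
      (fun y ↦ TotalSpace.mk' (E →L[ℝ] ℝ) (E := fun x : M ↦ Cotangent E x) y
        ((h i • θ i) y)) x := fun i ↦ (hh i).smul_section (hθ i)
  have h1 : ∀ᶠ y in 𝓝 x, differential f y = ∑ i, (h i • θ i) y := by
    filter_upwards [extend_coframe_apply_extend_frame (E := E) x] with y hy
    exact (sum_smul_eq_of_dual hy (mvfderiv 𝓘(ℝ, E) f y)).symm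
  rw [Dc.isCovariantDerivativeOnUniv.congr_of_eventuallyEq (σ' := fun y ↦ ∑ i, (h i • θ i) y)
      (differential f).mdifferentiableAt (.sum_section fun i _ ↦ hhθ i) Filter.univ_mem h1,
    Dc.isCovariantDerivativeOnUniv.sum_sections _ (Set.mem_univ x) fun i _ ↦ hhθ i]
  refine Finset.sum_congr rfl fun i _ ↦ ?_
  rw [Dc.isCovariantDerivativeOnUniv.leibniz (hθ i) (hh i)]
  have e1 : h i x = mvfderiv 𝓘(ℝ, E) f x (frame x i) := by
    simp only [h, FiberBundle.extend_apply_self]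
  have e2 : θ i x = coframe x i := FiberBundle.extend_apply_self _ _
  rw [e1, e2]

/-- Leibniz rule for the second derivative, from ∇(fs) = f ∇s + df ⊗ s. The terms in which both the
frame coefficients of df and the coframe are differentiated reassemble into ∇_c df by
`covariantDerivative_differential`. The sum of the two cross terms is symmetric in `X` and `Y`,
hence unchanged by symmetrization. -/
theorem covDerivForm_funSmul [T2Space M]
    (Dc : CovariantDerivative 𝓘(ℝ, E) (E →L[ℝ] ℝ) (fun x : M ↦ Cotangent E x))
    {D : CovariantDerivative 𝓘(ℝ, E) F V}
    (hD : CovariantDerivative.ContMDiffCovariantDerivative D ∞)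
    (f : C^∞⟮𝓘(ℝ, E), M; 𝓘(ℝ, ℝ), ℝ⟯) (s : Sections E F V) (x : M)
    (X Y : TangentSpace 𝓘(ℝ, E) x) :
    covDerivForm Dc D (D (funSmul f s)) x X Y =
      f x • covDerivForm Dc D (D s) x X Y + mvfderiv 𝓘(ℝ, E) f x X • D s x Y +
        mvfderiv 𝓘(ℝ, E) f x Y • D s x X + (Dc (differential f) x X) Y • s x := by
  let h : Fin (Module.finrank ℝ E) → M → ℝ := fun i y ↦
    mvfderiv 𝓘(ℝ, E) f y (FiberBundle.extend E (frame (E := E) x i) y)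
  let β : Fin (Module.finrank ℝ E) → Π y : M, V y := fun i y ↦
    D s y (FiberBundle.extend E (frame (E := E) x i) y)
  have hh : ∀ i, MDifferentiableAt 𝓘(ℝ, E) 𝓘(ℝ, ℝ) (h i) x := fun i ↦
    mdifferentiableAt_mvfderiv_extend f _
  have hβ : ∀ i, MDifferentiableAt 𝓘(ℝ, E) (𝓘(ℝ, E).prod 𝓘(ℝ, F))
      (fun y ↦ TotalSpace.mk' F y (β i y)) x := fun i ↦
    mdifferentiableAt_covariantDerivative_extend hD s _
  have hD1 : ∀ i, D (fun y ↦ D (funSmul f s) y (FiberBundle.extend E (frame (E := E) x i) y)) x =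
      f x • D (β i) x + (mvfderiv 𝓘(ℝ, E) f x).smulRight (D s x (frame x i)) +
        (mvfderiv 𝓘(ℝ, E) f x (frame x i) • D s x +
          (mvfderiv 𝓘(ℝ, E) (h i) x).smulRight (s x)) := by
    intro i
    have e : (fun y ↦ D (funSmul f s) y (FiberBundle.extend E (frame (E := E) x i) y)) =
        (f : M → ℝ) • β i + h i • (s : Π y, V y) := by
      ext y
      rw [covariantDerivative_funSmul]
      rfl
    rw [e, D.isCovariantDerivativeOnUniv.add (f.mdifferentiableAt.smul_section (hβ i))
        ((hh i).smul_section s.mdifferentiableAt),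
      D.isCovariantDerivativeOnUniv.leibniz (hβ i) f.mdifferentiableAt,
      D.isCovariantDerivativeOnUniv.leibniz s.mdifferentiableAt (hh i)]
    simp only [h, β, FiberBundle.extend_apply_self]
  have hY : ∑ i, coframe x i Y • D s x (frame x i) = D s x Y := by
    conv_rhs => rw [← sum_coframe_smul_frame x Y]
    simp
  have hY' : ∑ i, coframe x i Y * mvfderiv 𝓘(ℝ, E) f x (frame x i) = mvfderiv 𝓘(ℝ, E) f x Y := by
    conv_rhs => rw [← sum_coframe_smul_frame x Y]
    simp
  have hterm : ∀ i, coframe x i Y •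
        D (fun y ↦ D (funSmul f s) y (FiberBundle.extend E (frame (E := E) x i) y)) x X +
      (Dc (FiberBundle.extend (E := fun x : M ↦ Cotangent E x) (E →L[ℝ] ℝ) (coframe x i)) x X) Y •
        D (funSmul f s) x (frame x i) =
      f x • (coframe x i Y • D (β i) x X +
        (Dc (FiberBundle.extend (E := fun x : M ↦ Cotangent E x) (E →L[ℝ] ℝ)
          (coframe x i)) x X) Y • D s x (frame x i)) +
      mvfderiv 𝓘(ℝ, E) f x X • (coframe x i Y • D s x (frame x i)) +
      (coframe x i Y * mvfderiv 𝓘(ℝ, E) f x (frame x i)) • D s x X +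
      (mvfderiv 𝓘(ℝ, E) f x (frame x i) *
        (Dc (FiberBundle.extend (E := fun x : M ↦ Cotangent E x) (E →L[ℝ] ℝ)
          (coframe x i)) x X) Y + mvfderiv 𝓘(ℝ, E) (h i) x X * coframe x i Y) • s x := by
    intro i
    rw [hD1, covariantDerivative_funSmul]
    simp only [add_apply, smul_apply, ContinuousLinearMap.smulRight_apply]
    module
  unfold covDerivForm
  rw [covariantDerivative_differential, Finset.sum_congr rfl fun i _ ↦ hterm i]
  simp only [Finset.sum_add_distrib, ← Finset.smul_sum, ← Finset.sum_smul, hY, hY']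
  congr 2
  simp [h]

/-- By symmetry of σ the two cross terms df(X) ∇_Y s and df(Y) ∇_X s have the same contraction,
which absorbs the factor 1/2 of the quantization. The terms with second derivatives of `s` cancel in
the commutator. -/
theorem funCommutator_quantizeTwo [T2Space M]
    (Dc : CovariantDerivative 𝓘(ℝ, E) (E →L[ℝ] ℝ) (fun x : M ↦ Cotangent E x))
    {D : CovariantDerivative 𝓘(ℝ, E) F V}
    (hD : CovariantDerivative.ContMDiffCovariantDerivative D ∞) (σ : SymbolsTwo E F V)
    (f : C^∞⟮𝓘(ℝ, E), M; 𝓘(ℝ, ℝ), ℝ⟯) (s : Sections E F V) (x : M) :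
    funCommutator f (quantizeTwo Dc D σ) s x =
      ∑ j, σ x (mvfderiv 𝓘(ℝ, E) f x) (coframe x j) (D s x (frame x j)) +
        (1 / 2 : ℝ) • ∑ i, ∑ j, σ x (coframe x i) (coframe x j)
          ((Dc (differential f) x (frame x i)) (frame x j) • s x) := by
  have h1 : ∀ X Y, symSecondDeriv Dc D (funSmul f s) x X Y = f x • symSecondDeriv Dc D s x X Y +
      (mvfderiv 𝓘(ℝ, E) f x X • D s x Y + mvfderiv 𝓘(ℝ, E) f x Y • D s x X) +
      (1 / 2 : ℝ) • (((Dc (differential f) x X) Y) • s x + ((Dc (differential f) x Y) X) • s x) := by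
    intro X Y
    unfold symSecondDeriv
    rw [covDerivForm_funSmul Dc hD, covDerivForm_funSmul Dc hD]
    module
  have h2 : ∑ i, ∑ j, σ x (coframe x i) (coframe x j)
      (mvfderiv 𝓘(ℝ, E) f x (frame x i) • D s x (frame x j)) =
      ∑ j, σ x (mvfderiv 𝓘(ℝ, E) f x) (coframe x j) (D s x (frame x j)) := by
    rw [Finset.sum_comm]
    refine Finset.sum_congr rfl fun j _ ↦ ?_
    conv_rhs => rw [← sum_smul_eq_of_dual (coframe_apply_frame x) (mvfderiv 𝓘(ℝ, E) f x)]
    simp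
  have h3 : ∀ B : Fin (Module.finrank ℝ E) → Fin (Module.finrank ℝ E) → V x,
      ∑ i, ∑ j, σ x (coframe x i) (coframe x j) (B j i) =
        ∑ i, ∑ j, σ x (coframe x i) (coframe x j) (B i j) := by
    intro B
    rw [Finset.sum_comm]
    refine Finset.sum_congr rfl fun i _ ↦ Finset.sum_congr rfl fun j _ ↦ ?_
    rw [σ.symm]
  have h4 : ∑ i, ∑ j, σ x (coframe x i) (coframe x j)
        (symSecondDeriv Dc D (funSmul f s) x (frame x i) (frame x j)) =
      f x • ∑ i, ∑ j, σ x (coframe x i) (coframe x j)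
        (symSecondDeriv Dc D s x (frame x i) (frame x j)) +
      (∑ i, ∑ j, σ x (coframe x i) (coframe x j)
        (mvfderiv 𝓘(ℝ, E) f x (frame x i) • D s x (frame x j)) +
      ∑ i, ∑ j, σ x (coframe x i) (coframe x j)
        (mvfderiv 𝓘(ℝ, E) f x (frame x j) • D s x (frame x i))) +
      (1 / 2 : ℝ) • (∑ i, ∑ j, σ x (coframe x i) (coframe x j)
        ((Dc (differential f) x (frame x i)) (frame x j) • s x) +
      ∑ i, ∑ j, σ x (coframe x i) (coframe x j)
        ((Dc (differential f) x (frame x j)) (frame x i) • s x)) := by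
    simp only [Finset.smul_sum, ← Finset.sum_add_distrib]
    refine Finset.sum_congr rfl fun i _ ↦ Finset.sum_congr rfl fun j _ ↦ ?_
    rw [h1]
    simp only [map_add, map_smul]
  unfold funCommutator quantizeTwo
  rw [h4, h3 (fun i j ↦ mvfderiv 𝓘(ℝ, E) f x (frame x i) • D s x (frame x j)), h2,
    h3 (fun i j ↦ (Dc (differential f) x (frame x i)) (frame x j) • s x)]
  module

end Quantization

/-! ### Derivations and function-linear maps at a point. -/

section PointwiseSymbols

variable {E : Type*} [NormedAddCommGroup E] [NormedSpace ℝ E] [FiniteDimensional ℝ E]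
  {M : Type*} [TopologicalSpace M] [ChartedSpace E M] [IsManifold 𝓘(ℝ, E) ∞ M]
  {F : Type*} [NormedAddCommGroup F] [NormedSpace ℝ F]
  {V : M → Type*} [TopologicalSpace (TotalSpace F V)]
  [∀ x, AddCommGroup (V x)] [∀ x, Module ℝ (V x)] [∀ x, TopologicalSpace (V x)]
  [FiberBundle F V] [VectorBundle ℝ F V]
  [∀ x, IsTopologicalAddGroup (V x)] [∀ x, ContinuousSMul ℝ (V x)]

/-- Locality of derivations: if χ(x) = 1 and χ is supported where `f` vanishes, then 0 = L(χf) =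
L(f), as f(x) = 0. -/
theorem map_eq_zero_of_eventually_eq_zero [T2Space M] {W : Type*} [AddCommGroup W] [Module ℝ W]
    {x : M} (L : C^∞⟮𝓘(ℝ, E), M; 𝓘(ℝ, ℝ), ℝ⟯ →+ W)
    (hL : ∀ f g, L (f * g) = f x • L g + g x • L f) {f : C^∞⟮𝓘(ℝ, E), M; 𝓘(ℝ, ℝ), ℝ⟯}
    (hf : ∀ᶠ y in 𝓝 x, f y = 0) : L f = 0 := by
  obtain ⟨χ, h1, h2⟩ := exists_contMDiffMap_eventuallyEq_one (E := E) hf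
  have h3 : χ * f = 0 := by
    ext y
    by_cases hy : f y = 0
    · simp [hy]
    · have : χ y = 0 := image_eq_zero_of_notMem_tsupport fun h ↦ hy (h2 h)
      simp [this]
  have h4 := hL χ f
  rw [h3, map_zero, h1.self_of_nhds, hf.self_of_nhds] at h4
  simpa using h4.symm

/-- By locality the expansion near `x` may be differentiated term by term. Each factor uᵢ − uᵢ(x)
vanishes at `x`, so the Leibniz rule leaves only its own derivative. -/
theorem map_eq_sum_of_eventually_eq [T2Space M] {W : Type*} [AddCommGroup W] [Module ℝ W] {x : M}
    {ι : Type*} [Fintype ι] {f : C^∞⟮𝓘(ℝ, E), M; 𝓘(ℝ, ℝ), ℝ⟯} {u g : ι → C^∞⟮𝓘(ℝ, E), M; 𝓘(ℝ, ℝ), ℝ⟯}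
    (hg : ∀ᶠ y in 𝓝 x, f y = f x + ∑ i, (u i y - u i x) * g i y)
    (L : C^∞⟮𝓘(ℝ, E), M; 𝓘(ℝ, ℝ), ℝ⟯ →+ W) (hL : ∀ f g, L (f * g) = f x • L g + g x • L f)
    (hLc : ∀ c : ℝ, L (ContMDiffMap.const c) = 0) : L f = ∑ i, g i x • L (u i) := by
  let v : ι → C^∞⟮𝓘(ℝ, E), M; 𝓘(ℝ, ℝ), ℝ⟯ := fun i ↦ u i - ContMDiffMap.const (u i x)
  let r : C^∞⟮𝓘(ℝ, E), M; 𝓘(ℝ, ℝ), ℝ⟯ := ∑ i, v i * g i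
  have h1 : L (f - (ContMDiffMap.const (f x) + r)) = 0 := by
    refine map_eq_zero_of_eventually_eq_zero L hL ?_
    filter_upwards [hg] with y hy
    have h2 : r y = ∑ i, (u i y - u i x) * g i y :=
      (congrFun (map_sum ContMDiffMap.coeFnAddMonoidHom (fun i ↦ v i * g i) Finset.univ) y).trans
        (Finset.sum_apply _ _ _)
    change f y - (f x + r y) = 0
    rw [h2, hy, sub_self]
  rw [map_sub, map_add, hLc, zero_add, map_sum, sub_eq_zero] at h1
  rw [h1]
  refine Finset.sum_congr rfl fun i _ ↦ ?_
  have h3 : v i x = 0 := sub_self (u i x)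
  rw [hL, h3, zero_smul, zero_add, map_sub, hLc, sub_zero]

/-- A derivation at a point is determined by its values on local coordinates. -/
theorem derivation_eq_sum_coordinates [T2Space M] {W : Type*} [AddCommGroup W] [Module ℝ W] {x : M}
    {u : Fin (Module.finrank ℝ E) → C^∞⟮𝓘(ℝ, E), M; 𝓘(ℝ, ℝ), ℝ⟯}
    {X : Fin (Module.finrank ℝ E) → TangentSpace 𝓘(ℝ, E) x}
    (huX : ∀ i j, mvfderiv 𝓘(ℝ, E) (u i) x (X j) = if i = j then 1 else 0)
    (hu : ∀ f : C^∞⟮𝓘(ℝ, E), M; 𝓘(ℝ, ℝ), ℝ⟯, ∃ g : Fin (Module.finrank ℝ E) → C^∞⟮𝓘(ℝ, E), M; 𝓘(ℝ, ℝ), ℝ⟯,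
      ∀ᶠ y in 𝓝 x, f y = f x + ∑ i, (u i y - u i x) * g i y)
    (L : C^∞⟮𝓘(ℝ, E), M; 𝓘(ℝ, ℝ), ℝ⟯ →+ W) (hL : ∀ f g, L (f * g) = f x • L g + g x • L f)
    (hLc : ∀ c : ℝ, L (ContMDiffMap.const c) = 0) (f : C^∞⟮𝓘(ℝ, E), M; 𝓘(ℝ, ℝ), ℝ⟯) :
    L f = ∑ i, mvfderiv 𝓘(ℝ, E) f x (X i) • L (u i) := by
  obtain ⟨g, hg⟩ := hu f
  -- The values at `x` of the Hadamard coefficients are identified by applying the expansion to the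
  -- derivation f ↦ df(Xⱼ) itself.
  have hd : ∀ j, mvfderiv 𝓘(ℝ, E) f x (X j) = g j x := by
    intro j
    have h1 := map_eq_sum_of_eventually_eq hg
      (AddMonoidHom.mk' (fun f : C^∞⟮𝓘(ℝ, E), M; 𝓘(ℝ, ℝ), ℝ⟯ ↦ mvfderiv 𝓘(ℝ, E) f x (X j)) fun f g ↦
        congr($(mvfderiv_add f.mdifferentiableAt g.mdifferentiableAt) (X j)))
      (fun f g ↦ congr($(mvfderiv_mul f.mdifferentiableAt g.mdifferentiableAt) (X j)))
      (fun c ↦ congr($(mvfderiv_const c) (X j)))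
    simpa [huX] using h1
  simp_rw [hd]
  exact map_eq_sum_of_eventually_eq hg L hL hLc

theorem funSmul_add_right (f : C^∞⟮𝓘(ℝ, E), M; 𝓘(ℝ, ℝ), ℝ⟯) (s t : Sections E F V) :
    funSmul f (s + t) = funSmul f s + funSmul f t := by
  ext y; exact smul_add _ _ _

theorem funSmul_add_left (f g : C^∞⟮𝓘(ℝ, E), M; 𝓘(ℝ, ℝ), ℝ⟯) (s : Sections E F V) :
    funSmul (f + g) s = funSmul f s + funSmul g s := by
  ext y; exact add_smul _ _ _

theorem funSmul_mul (f g : C^∞⟮𝓘(ℝ, E), M; 𝓘(ℝ, ℝ), ℝ⟯) (s : Sections E F V) :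
    funSmul (f * g) s = funSmul f (funSmul g s) := by
  ext y; exact mul_smul _ _ _

theorem funSmul_const (c : ℝ) (s : Sections E F V) :
    funSmul (ContMDiffMap.const c) s = c • s := by
  ext y; rfl

variable [FiniteDimensional ℝ F] [ContMDiffVectorBundle ∞ F V 𝓘(ℝ, E)]

/-- A map on global sections that is linear over the functions evaluated at a point factors
through the value of the section at that point. -/
theorem exists_linearMap_of_funSmul [T2Space M] {W : Type*} [AddCommGroup W] [Module ℝ W] {x : M}
    (K : Sections E F V →+ W) (hK : ∀ f s, K (funSmul f s) = f x • K s) :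
    ∃ k : V x →ₗ[ℝ] W, ∀ s, K s = k (s x) := by
  have : ContMDiffVectorBundle 1 F V 𝓘(ℝ, E) := .of_le (n := ∞) (by simp)
  have hloc : ∀ s : Sections E F V, (∀ᶠ y in 𝓝 x, s y = 0) → K s = 0 := by
    intro s hs
    obtain ⟨χ, h1, h2⟩ := exists_contMDiffMap_eventuallyEq_one (E := E) hs
    have h3 : funSmul χ s = 0 := by
      ext y
      change χ y • s y = 0
      by_cases hy : s y = 0
      · simp [hy]
      · have : χ y = 0 := image_eq_zero_of_notMem_tsupport fun h ↦ hy (h2 h)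
        simp [this]
    have h4 := hK χ s
    rw [h3, map_zero, h1.self_of_nhds, one_smul] at h4
    exact h4.symm
  -- Near `x` the section is a sum of terms cᵢ Sᵢ with global cᵢ and Sᵢ that extend its coefficients
  -- and a local frame. If s(x) = 0, then every cᵢ(x) = 0, and K(cᵢ Sᵢ) = cᵢ(x) K(Sᵢ) vanishes.
  have hzero : ∀ s : Sections E F V, s x = 0 → K s = 0 := by
    intro s hs
    let e := trivializationAt F V x
    have he : e.baseSet ∈ 𝓝 x :=
      e.open_baseSet.mem_nhds (FiberBundle.mem_baseSet_trivializationAt' x)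
    let b := Module.finBasis ℝ F
    have hc : ∀ i, ∃ c : C^∞⟮𝓘(ℝ, E), M; 𝓘(ℝ, ℝ), ℝ⟯, ∀ᶠ y in 𝓝 x,
        c y = e.localFrameCoeff 𝓘(ℝ, E) b i y (s y) := fun i ↦
      exists_contMDiffMap_eventuallyEq he
        (contMDiffOn_baseSet_localFrameCoeff (k := ∞) b s.contMDiff.contMDiffOn i)
    have hS : ∀ i, ∃ S : Sections E F V, ∀ᶠ y in 𝓝 x, S y = e.localFrame b i y := fun i ↦
      exists_section_eventuallyEq he (e.contMDiffOn_localFrame_baseSet ∞ b i)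
    choose c hc using hc
    choose S hS using hS
    have h1 : K (s - ∑ i, funSmul (c i) (S i)) = 0 := by
      refine hloc _ ?_
      filter_upwards [Filter.eventually_all.2 hc, Filter.eventually_all.2 hS, he] with y h2 h3 h4
      have h5 : (∑ i, funSmul (c i) (S i)) y = ∑ i, c i y • S i y := by
        rw [← ContMDiffSection.coeAddHom_apply, map_sum, Finset.sum_apply]
        rfl
      change s y - _ = 0
      rw [h5, sub_eq_zero, e.eq_sum_localFrameCoeff_smul (I := 𝓘(ℝ, E)) (s := s) (b := b) h4]
      simp only [h2, h3]
    rw [map_sub, map_sum, sub_eq_zero] at h1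
    rw [h1]
    refine Finset.sum_eq_zero fun i _ ↦ ?_
    rw [hK, (hc i).self_of_nhds, hs, map_zero, zero_smul]
  choose S hS using fun v : V x ↦ exists_section_apply_eq (E := E) (F := F) v
  have hval : ∀ s t : Sections E F V, s x = t x → K s = K t := fun s t h ↦ by
    rw [← sub_eq_zero, ← map_sub]
    exact hzero _ (sub_eq_zero.2 h)
  refine ⟨⟨⟨fun v ↦ K (S v), fun v w ↦ ?_⟩, fun c v ↦ ?_⟩, fun s ↦ hval _ _ (hS _).symm⟩
  · rw [← map_add]
    exact hval _ _ (by simp [hS])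
  · have : c • K (S v) = K (funSmul (ContMDiffMap.const c) (S v)) :=
      (hK (ContMDiffMap.const c) (S v)).symm
    simp only [RingHom.id_apply]
    rw [this, funSmul_const]
    exact hval _ _ (by simp [hS])

/-- An operation on functions and sections that is a derivation at `x` in the function and linear
over the functions in the section is given by a linear map of the differential and the value. -/
theorem exists_symbol_of_derivation [T2Space M] {x : M}
    (T : C^∞⟮𝓘(ℝ, E), M; 𝓘(ℝ, ℝ), ℝ⟯ → Sections E F V → V x)
    (hadd : ∀ f g s, T (f + g) s = T f s + T g s)
    (hmul : ∀ f g s, T (f * g) s = f x • T g s + g x • T f s)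
    (hconst : ∀ (c : ℝ) s, T (ContMDiffMap.const c) s = 0)
    (hadd' : ∀ f s t, T f (s + t) = T f s + T f t)
    (hsmul : ∀ f g s, T f (funSmul g s) = g x • T f s) :
    ∃ t : Cotangent E x →ₗ[ℝ] Module.End ℝ (V x), ∀ f s,
      T f s = t (mvfderiv 𝓘(ℝ, E) f x) (s x) := by
  obtain ⟨u, X, huX, hu⟩ := exists_coordinates (E := E) x
  choose k hk using fun i ↦ exists_linearMap_of_funSmul
    (AddMonoidHom.mk' (T (u i)) (hadd' (u i))) (hsmul (u i))
  -- The symbol is the sum of the Xᵢ ⊗ kᵢ, where kᵢ is the endomorphism of the fibre induced by `T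
  -- (u i)`.
  refine ⟨∑ i, (LinearMap.toSpanSingleton ℝ (Module.End ℝ (V x)) (k i)) ∘ₗ
    { toFun := fun θ : Cotangent E x ↦ θ (X i x)
      map_add' := fun _ _ ↦ rfl
      map_smul' := fun _ _ ↦ rfl }, fun f s ↦ ?_⟩
  have h1 := derivation_eq_sum_coordinates huX.self_of_nhds hu
    (AddMonoidHom.mk' (fun f ↦ T f s) (fun f g ↦ hadd f g s)) (fun f g ↦ hmul f g s)
    (fun c ↦ hconst c s) f
  have h2 : ∀ i, T (u i) s = k i (s x) := fun i ↦ hk i s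
  simp only [AddMonoidHom.mk'_apply] at h1
  rw [h1]
  simp [h2]

end PointwiseSymbols

/-! ### Existence and smoothness of the subsymbol. -/

section Subsymbols

variable {E : Type*} [NormedAddCommGroup E] [NormedSpace ℝ E] [FiniteDimensional ℝ E]
  {M : Type*} [TopologicalSpace M] [ChartedSpace E M] [IsManifold 𝓘(ℝ, E) ∞ M]
  {F : Type*} [NormedAddCommGroup F] [NormedSpace ℝ F]
  {V : M → Type*} [TopologicalSpace (TotalSpace F V)]
  [∀ x, AddCommGroup (V x)] [∀ x, Module ℝ (V x)] [∀ x, TopologicalSpace (V x)]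
  [FiberBundle F V] [VectorBundle ℝ F V]
  [∀ x, IsTopologicalAddGroup (V x)] [∀ x, ContinuousSMul ℝ (V x)]
  [ContMDiffVectorBundle ∞ F V 𝓘(ℝ, E)]

theorem funCommutator_sub (f : C^∞⟮𝓘(ℝ, E), M; 𝓘(ℝ, ℝ), ℝ⟯) (B B' : Sections E F V → Π x, V x)
    (s : Sections E F V) (x : M) :
    funCommutator f (fun s x ↦ B s x - B' s x) s x = funCommutator f B s x -
      funCommutator f B' s x := by
  simp only [funCommutator, smul_sub]
  abel

/-- The basis `frame x` refers to the preferred chart at `x` and need not vary continuously, so the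
summands need not be smooth. Near each point `sum_coframe_frame_eq` replaces the bases by the smooth
dual frames duⱼ, Xⱼ. -/
theorem contMDiff_contraction_one [T2Space M] (σ : SymbolsTwo E F V)
    {D : CovariantDerivative 𝓘(ℝ, E) F V}
    (hD : CovariantDerivative.ContMDiffCovariantDerivative D ∞)
    (f : C^∞⟮𝓘(ℝ, E), M; 𝓘(ℝ, ℝ), ℝ⟯) (s : Sections E F V) :
    IsSmoothSection E F V (fun x ↦
      ∑ j, σ x (mvfderiv 𝓘(ℝ, E) f x) (coframe x j) (D s x (frame x j))) := by
  intro x₀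
  obtain ⟨u, X, huX, -⟩ := exists_coordinates (E := E) x₀
  let β : Fin (Module.finrank ℝ E) → Sections E F V := fun j ↦
    ⟨fun x ↦ D s x (X j x), (contMDiff_covariantDerivative hD s).clm_bundle_apply (X j).contMDiff⟩
  have h1 : ContMDiffAt 𝓘(ℝ, E) (𝓘(ℝ, E).prod 𝓘(ℝ, F)) ∞ (fun x ↦ TotalSpace.mk' F x
      (∑ j, σ x (differential f x) (differential (u j) x) (β j x))) x₀ :=
    .sum_section fun j _ ↦ (σ.smooth (differential f) (differential (u j)) (β j)) x₀
  refine h1.congr_of_eventuallyEq ?_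
  filter_upwards [huX] with x hx
  exact congrArg _ (sum_coframe_frame_eq (LinearMap.mk₂ ℝ
    (fun θ v ↦ σ x (mvfderiv 𝓘(ℝ, E) f x) θ (D s x v)) (by simp) (by simp) (by simp) (by simp)) hx)

theorem contMDiff_contraction_two [T2Space M] (σ : SymbolsTwo E F V)
    {Dc : CovariantDerivative 𝓘(ℝ, E) (E →L[ℝ] ℝ) (fun x : M ↦ Cotangent E x)}
    (hDc : CovariantDerivative.ContMDiffCovariantDerivative Dc ∞)
    (f : C^∞⟮𝓘(ℝ, E), M; 𝓘(ℝ, ℝ), ℝ⟯) (s : Sections E F V) :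
    IsSmoothSection E F V (fun x ↦ ∑ i, ∑ j, σ x (coframe x i) (coframe x j)
      ((Dc (differential f) x (frame x i)) (frame x j) • s x)) := by
  intro x₀
  obtain ⟨u, X, huX, -⟩ := exists_coordinates (E := E) x₀
  have h0 : ∀ i j, ContMDiff 𝓘(ℝ, E) 𝓘(ℝ, ℝ) ∞
      (fun x ↦ (Dc (differential f) x (X i x)) (X j x)) := by
    intro i j x
    have h1 := (contMDiff_covariantDerivative hDc (differential f)).clm_bundle_apply
      (X i).contMDiff
    have h2 := ContMDiff.clm_bundle_apply (E₂ := fun _ : M ↦ ℝ) h1 (X j).contMDiff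
    exact (contMDiffAt_section _).1 (h2 x)
  let β : Fin (Module.finrank ℝ E) → Fin (Module.finrank ℝ E) → Sections E F V := fun i j ↦
    funSmul ⟨_, h0 i j⟩ s
  have h1 : ContMDiffAt 𝓘(ℝ, E) (𝓘(ℝ, E).prod 𝓘(ℝ, F)) ∞ (fun x ↦ TotalSpace.mk' F x
      (∑ i, ∑ j, σ x (differential (u i) x) (differential (u j) x) (β i j x))) x₀ :=
    .sum_section fun i _ ↦ .sum_section fun j _ ↦
      (σ.smooth (differential (u i)) (differential (u j)) (β i j)) x₀
  refine h1.congr_of_eventuallyEq ?_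
  filter_upwards [huX] with x hx
  refine congrArg _ ?_
  -- The two contractions are independent, so the bases are changed in one pair of slots at a time.
  have h2 : ∀ (θ : Cotangent E x) (v : TangentSpace 𝓘(ℝ, E) x),
      ∑ j, σ x θ (coframe x j) ((Dc (differential f) x v) (frame x j) • s x) =
      ∑ j, σ x θ (differential (u j) x) ((Dc (differential f) x v) (X j x) • s x) := fun θ v ↦
    sum_coframe_frame_eq (LinearMap.mk₂ ℝ
      (fun η w ↦ σ x θ η ((Dc (differential f) x v) w • s x)) (by simp) (fun _ _ _ ↦ by simp [smul_smul, mul_comm])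
      (by simp [add_smul]) (by simp [mul_smul])) hx
  simp_rw [h2]
  exact sum_coframe_frame_eq (LinearMap.mk₂ ℝ
    (fun θ v ↦ ∑ j, σ x θ (differential (u j) x) ((Dc (differential f) x v) (X j x) • s x))
    (by simp [Finset.sum_add_distrib]) (fun _ _ _ ↦ by
      rw [Finset.smul_sum]
      exact Finset.sum_congr rfl fun _ _ ↦ by simp [smul_smul, mul_comm])
    (by simp [add_smul, Finset.sum_add_distrib]) (by simp [mul_smul, Finset.smul_sum])) hx

theorem contMDiff_funCommutator_quantizeTwo [T2Space M]
    {Dc : CovariantDerivative 𝓘(ℝ, E) (E →L[ℝ] ℝ) (fun x : M ↦ Cotangent E x)}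
    (hDc : CovariantDerivative.ContMDiffCovariantDerivative Dc ∞)
    {D : CovariantDerivative 𝓘(ℝ, E) F V}
    (hD : CovariantDerivative.ContMDiffCovariantDerivative D ∞) (σ : SymbolsTwo E F V)
    (f : C^∞⟮𝓘(ℝ, E), M; 𝓘(ℝ, ℝ), ℝ⟯) (s : Sections E F V) :
    IsSmoothSection E F V (funCommutator f (quantizeTwo Dc D σ) s) := by
  have h := (contMDiff_contraction_one σ hD f s).add_section
    ((contMDiff_contraction_two σ hDc f s).const_smul_section (a := (1 / 2 : ℝ)))
  exact h.congr fun x ↦ congrArg _ (funCommutator_quantizeTwo Dc hD σ f s x)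

/-- Every second order operator has a subsymbol with respect to any pair of smooth connections. -/
theorem exists_isSubsymbolOne [T2Space M] [FiniteDimensional ℝ F]
    {A : Sections E F V →ₗ[ℝ] Sections E F V} {σ : SymbolsTwo E F V}
    (hσ : IsSymbolTwo (fun s ↦ ⇑(A s)) σ)
    {Dc : CovariantDerivative 𝓘(ℝ, E) (E →L[ℝ] ℝ) (fun x : M ↦ Cotangent E x)}
    (hDc : CovariantDerivative.ContMDiffCovariantDerivative Dc ∞)
    {D : CovariantDerivative 𝓘(ℝ, E) F V}
    (hD : CovariantDerivative.ContMDiffCovariantDerivative D ∞) :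
    ∃ τ : SymbolsOne E F V, IsSubsymbolOne Dc D A σ τ := by
  let T : C^∞⟮𝓘(ℝ, E), M; 𝓘(ℝ, ℝ), ℝ⟯ → Sections E F V → Π x, V x := fun f ↦
    funCommutator f (fun s x ↦ A s x - quantizeTwo Dc D σ s x)
  have hT : ∀ f s x, T f s x = (A (funSmul f s) x - f x • A s x) -
      (∑ j, σ x (mvfderiv 𝓘(ℝ, E) f x) (coframe x j) (D s x (frame x j)) +
        (1 / 2 : ℝ) • ∑ i, ∑ j, σ x (coframe x i) (coframe x j)
          ((Dc (differential f) x (frame x i)) (frame x j) • s x)) := by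
    intro f s x
    rw [← funCommutator_quantizeTwo Dc hD σ f s x]
    exact funCommutator_sub f (fun s ↦ ⇑(A s)) _ s x
  -- The identity [B, fg] = f [B, g] + [B, f] g holds for every operator; it becomes a Leibniz rule
  -- at `x` once `hsmul` is known.
  have hmul : ∀ f g s x, T (f * g) s x = f x • T g s x + T f (funSmul g s) x := by
    intro f g s x
    have h : (f * g) x = f x * g x := rfl
    simp only [T, funCommutator, funSmul_mul, h]
    module
  -- Here the order drops to 1: `h1` and `h2` produce the same term ⟨σ, df · dg⟩ s, once from A and
  -- once from the quantization, and the two cancel.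
  have hsmul : ∀ f g s x, T f (funSmul g s) x = g x • T f s x := by
    intro f g s x
    have h1 : A (funSmul f (funSmul g s)) x - f x • A (funSmul g s) x =
        g x • (A (funSmul f s) x - f x • A s x) +
          σ x (mvfderiv 𝓘(ℝ, E) f x) (mvfderiv 𝓘(ℝ, E) g x) (s x) := by
      have h := hσ g f s x
      simp only [funCommutator] at h
      rw [σ.symm, ← h]
      abel
    have h2 : ∑ j, σ x (mvfderiv 𝓘(ℝ, E) f x) (coframe x j) (D (funSmul g s) x (frame x j)) =
        g x • ∑ j, σ x (mvfderiv 𝓘(ℝ, E) f x) (coframe x j) (D s x (frame x j)) +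
          σ x (mvfderiv 𝓘(ℝ, E) f x) (mvfderiv 𝓘(ℝ, E) g x) (s x) := by
      conv_rhs => rw [← sum_smul_eq_of_dual (coframe_apply_frame x) (mvfderiv 𝓘(ℝ, E) g x)]
      simp [covariantDerivative_funSmul, Finset.smul_sum, Finset.sum_add_distrib]
    have h3 : ∑ i, ∑ j, σ x (coframe x i) (coframe x j)
          ((Dc (differential f) x (frame x i)) (frame x j) • funSmul g s x) =
        g x • ∑ i, ∑ j, σ x (coframe x i) (coframe x j)
          ((Dc (differential f) x (frame x i)) (frame x j) • s x) := by
      simp only [Finset.smul_sum]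
      refine Finset.sum_congr rfl fun i _ ↦ Finset.sum_congr rfl fun j _ ↦ ?_
      rw [← map_smul, smul_comm]
      rfl
    rw [hT, hT, h1, h2, h3]
    module
  have hadd : ∀ f g s x, T (f + g) s x = T f s x + T g s x := by
    intro f g s x
    have h1 : ∀ y, mvfderiv 𝓘(ℝ, E) (f + g : C^∞⟮𝓘(ℝ, E), M; 𝓘(ℝ, ℝ), ℝ⟯) y =
        mvfderiv 𝓘(ℝ, E) f y + mvfderiv 𝓘(ℝ, E) g y := fun y ↦
      mvfderiv_add f.mdifferentiableAt g.mdifferentiableAt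
    have h2 : (differential (f + g) : Π y, Cotangent E y) =
        (differential f : Π y, Cotangent E y) + differential g := funext h1
    have h3 : (f + g) x = f x + g x := rfl
    rw [hT, hT, hT, funSmul_add_left, map_add, h1, h2, h3,
      Dc.isCovariantDerivativeOnUniv.add (differential f).mdifferentiableAt
        (differential g).mdifferentiableAt, ContMDiffSection.coe_add, Pi.add_apply]
    simp only [add_apply, LinearMap.add_apply, map_add, add_smul, Finset.sum_add_distrib, smul_add]
    abel
  have hadd' : ∀ f s t x, T f (s + t) x = T f s x + T f t x := by
    intro f s t x
    rw [hT, hT, hT, funSmul_add_right, map_add, map_add]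
    simp only [ContMDiffSection.coe_add]
    rw [D.isCovariantDerivativeOnUniv.add s.mdifferentiableAt t.mdifferentiableAt]
    simp only [Pi.add_apply, add_apply, map_add, Finset.sum_add_distrib, smul_add]
    abel
  have hconst : ∀ (c : ℝ) s x, T (ContMDiffMap.const c) s x = 0 := by
    intro c s x
    have h1 : ∀ y, mvfderiv 𝓘(ℝ, E)
        (ContMDiffMap.const c : C^∞⟮𝓘(ℝ, E), M; 𝓘(ℝ, ℝ), ℝ⟯) y = 0 := fun y ↦ mvfderiv_const c
    have h2 : (differential (ContMDiffMap.const c) : Π y, Cotangent E y) = 0 := funext h1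
    have h3 : (ContMDiffMap.const c : C^∞⟮𝓘(ℝ, E), M; 𝓘(ℝ, ℝ), ℝ⟯) x = c := rfl
    rw [hT, funSmul_const, map_smul, h1, h2, h3,
      Dc.isCovariantDerivativeOnUniv.zero (Set.mem_univ x)]
    simp
  have hsmooth : ∀ f s, IsSmoothSection E F V (T f s) := by
    intro f s
    have h := ((A (funSmul f s)).contMDiff.sub_section (funSmul f (A s)).contMDiff).sub_section
      (contMDiff_funCommutator_quantizeTwo hDc hD σ f s)
    exact h.congr fun x ↦ congrArg _ (funCommutator_sub f (fun s ↦ ⇑(A s)) _ s x)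
  choose t ht using fun x ↦ exists_symbol_of_derivation (fun f s ↦ T f s x)
    (fun f g s ↦ hadd f g s x) (fun f g s ↦ by rw [hmul, hsmul]) (fun c s ↦ hconst c s x)
    (fun f r s ↦ hadd' f r s x) (fun f g s ↦ hsmul f g s x)
  refine ⟨⟨t, fun θ s x₀ ↦ ?_⟩, fun f s x ↦ ht x f s⟩
  -- Smoothness of the symbol: near x₀ one has θ = ∑ⱼ θ(Xⱼ) duⱼ, so its value on θ and `s` is a
  -- combination of the smooth sections `T (u j) s` with smooth coefficients.
  obtain ⟨u, X, huX, -⟩ := exists_coordinates (E := E) x₀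
  have h0 : ∀ j, ContMDiff 𝓘(ℝ, E) 𝓘(ℝ, ℝ) ∞ (fun x ↦ θ x (X j x)) := fun j x ↦
    (contMDiffAt_section _).1
      (ContMDiff.clm_bundle_apply (E₂ := fun _ : M ↦ ℝ) θ.contMDiff (X j).contMDiff x)
  have h1 : ContMDiffAt 𝓘(ℝ, E) (𝓘(ℝ, E).prod 𝓘(ℝ, F)) ∞ (fun x ↦ TotalSpace.mk' F x
      (∑ j, (θ x (X j x)) • T (u j) s x)) x₀ :=
    .sum_section fun j _ ↦ (h0 j x₀).smul_section (hsmooth (u j) s x₀)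
  refine h1.congr_of_eventuallyEq ?_
  filter_upwards [huX] with x hx
  refine congrArg _ ?_
  conv_lhs => rw [← sum_smul_eq_of_dual hx (θ x)]
  simp [ht]

end Subsymbols

/-! ### The affine space of connections. -/

section ChangeOfConnection

variable {E : Type*} [NormedAddCommGroup E] [NormedSpace ℝ E] [FiniteDimensional ℝ E]
  {M : Type*} [TopologicalSpace M] [ChartedSpace E M] [IsManifold 𝓘(ℝ, E) ∞ M]
  {F : Type*} [NormedAddCommGroup F] [NormedSpace ℝ F]
  {V : M → Type*} [TopologicalSpace (TotalSpace F V)]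
  [∀ x, AddCommGroup (V x)] [∀ x, Module ℝ (V x)] [∀ x, TopologicalSpace (V x)]
  [FiberBundle F V] [VectorBundle ℝ F V]
  [∀ x, IsTopologicalAddGroup (V x)] [∀ x, ContinuousSMul ℝ (V x)]

theorem pairing_apply (x : M) (σ : Cotangent E x →ₗ[ℝ] Cotangent E x →ₗ[ℝ] Module.End ℝ (V x))
    (α : TangentSpace 𝓘(ℝ, E) x →ₗ[ℝ] Module.End ℝ (V x)) (θ : Cotangent E x) (v : V x) :
    pairing x σ α θ v = ∑ i, σ (coframe x i) θ (α (frame x i) v) := by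
  simp [pairing, LinearMap.sum_apply]

variable [ContMDiffVectorBundle ∞ F V 𝓘(ℝ, E)]

/-- Changing the connection by an endomorphism-valued form `α` changes the commutators of the
quantization by the pairing `⟨σ, α⟩`. -/
theorem funCommutator_quantizeTwo_of_eq_add [T2Space M]
    (Dc : CovariantDerivative 𝓘(ℝ, E) (E →L[ℝ] ℝ) (fun x : M ↦ Cotangent E x))
    {D D' : CovariantDerivative 𝓘(ℝ, E) F V}
    (hD : CovariantDerivative.ContMDiffCovariantDerivative D ∞)
    (hD' : CovariantDerivative.ContMDiffCovariantDerivative D' ∞) (σ : SymbolsTwo E F V)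
    (f : C^∞⟮𝓘(ℝ, E), M; 𝓘(ℝ, ℝ), ℝ⟯) {s : Sections E F V} {x : M}
    {α : TangentSpace 𝓘(ℝ, E) x →ₗ[ℝ] Module.End ℝ (V x)}
    (h : ∀ v, D' s x v = D s x v + α v (s x)) :
    funCommutator f (quantizeTwo Dc D' σ) s x = funCommutator f (quantizeTwo Dc D σ) s x +
      pairing x (σ x) α (mvfderiv 𝓘(ℝ, E) f x) (s x) := by
  rw [funCommutator_quantizeTwo Dc hD', funCommutator_quantizeTwo Dc hD, pairing_apply]
  -- The pairing has df in the second slot of σ, the commutator formula in the first.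
  simp only [h, map_add, Finset.sum_add_distrib, σ.symm x (coframe x _)
    (mvfderiv 𝓘(ℝ, E) f x)]
  abel

/-- Two linear maps on the cotangent space with values in the endomorphisms of the fibre are equal
if they agree on differentials of functions and values of sections. -/
theorem cotangent_hom_ext [T2Space M] [FiniteDimensional ℝ F] {x : M}
    {t t' : Cotangent E x →ₗ[ℝ] Module.End ℝ (V x)}
    (h : ∀ (f : C^∞⟮𝓘(ℝ, E), M; 𝓘(ℝ, ℝ), ℝ⟯) (s : Sections E F V),
      t (mvfderiv 𝓘(ℝ, E) f x) (s x) = t' (mvfderiv 𝓘(ℝ, E) f x) (s x)) : t = t' := by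
  obtain ⟨u, X, huX, -⟩ := exists_coordinates (E := E) x
  ext θ v
  obtain ⟨s, rfl⟩ := exists_section_apply_eq (E := E) (F := F) v
  rw [← sum_smul_eq_of_dual huX.self_of_nhds θ]
  simp [LinearMap.sum_apply, h]

/-- Adding a smooth endomorphism-valued form to a smooth connection. -/
theorem exists_covariantDerivative_eq_add [T2Space M] [FiniteDimensional ℝ F]
    {D : CovariantDerivative 𝓘(ℝ, E) F V}
    (hD : CovariantDerivative.ContMDiffCovariantDerivative D ∞) (α : EndForms E F V) :
    ∃ D' : CovariantDerivative 𝓘(ℝ, E) F V, CovariantDerivative.ContMDiffCovariantDerivative D' ∞ ∧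
      ∀ (s : Π x, V x) (x : M) (v : TangentSpace 𝓘(ℝ, E) x), D' s x v = D s x v + α x v (s x) := by
  have : ∀ x, T2Space (V x) := fun x ↦ FiberBundle.t2Space F V x
  have : ∀ x, FiniteDimensional ℝ (V x) := fun x ↦ VectorBundle.finiteDimensional ℝ F V x
  have : ∀ x : M, T2Space (TangentSpace 𝓘(ℝ, E) x) := fun _ ↦ inferInstanceAs (T2Space E)
  have : ∀ x : M, FiniteDimensional ℝ (TangentSpace 𝓘(ℝ, E) x) := fun _ ↦
    inferInstanceAs (FiniteDimensional ℝ E)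
  let B : Π x : M, V x →L[ℝ] TangentSpace 𝓘(ℝ, E) x →L[ℝ] V x := fun x ↦
    (LinearMap.flip (α x)).toContinuousBilinearMap
  have hB : ∀ (s : Π x, V x) (x : M) (v : TangentSpace 𝓘(ℝ, E) x),
      D.addOneForm B s x v = D s x v + α x v (s x) := fun s x v ↦ rfl
  refine ⟨D.addOneForm B, ⟨⟨fun {s} hs ↦ ?_⟩⟩, hB⟩
  let S : Sections E F V := ⟨s, by simpa using contMDiffOn_univ.1 hs⟩
  refine (contMDiff_hom_of_forall_vectorField fun X ↦ ?_).contMDiffOn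
  exact (((contMDiff_covariantDerivative hD S).clm_bundle_apply X.contMDiff).add_section
    (α.smooth X S)).congr fun x ↦ congrArg _ (hB s x (X x))

/-- The difference of two smooth connections is a smooth endomorphism-valued form. -/
theorem exists_endForms_eq_sub [T2Space M] [FiniteDimensional ℝ F]
    {D D' : CovariantDerivative 𝓘(ℝ, E) F V}
    (hD : CovariantDerivative.ContMDiffCovariantDerivative D ∞)
    (hD' : CovariantDerivative.ContMDiffCovariantDerivative D' ∞) :
    ∃ β : EndForms E F V, ∀ (s : Π x, V x) (x : M),
      MDifferentiableAt 𝓘(ℝ, E) (𝓘(ℝ, E).prod 𝓘(ℝ, F)) (fun y ↦ TotalSpace.mk' F y (s y)) x →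
      ∀ v : TangentSpace 𝓘(ℝ, E) x, D' s x v = D s x v + β x v (s x) := by
  have : ContMDiffVectorBundle 1 F V 𝓘(ℝ, E) := .of_le (n := ∞) (by simp)
  -- The Leibniz terms df ⊗ s cancel in the difference, which is therefore tensorial.
  let B : Π x : M, TangentSpace 𝓘(ℝ, E) x →ₗ[ℝ] Module.End ℝ (V x) := fun x ↦
    LinearMap.mk₂ ℝ (fun v w ↦ CovariantDerivative.difference D' D x w v)
      (by simp) (by simp) (by simp) (by simp)
  have hB : ∀ (s : Π x, V x) (x : M),
      MDifferentiableAt 𝓘(ℝ, E) (𝓘(ℝ, E).prod 𝓘(ℝ, F)) (fun y ↦ TotalSpace.mk' F y (s y)) x →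
      ∀ v : TangentSpace 𝓘(ℝ, E) x, B x v (s x) = D' s x v - D s x v := fun s x hs v ↦
    congr($(IsCovariantDerivativeOn.difference_apply D'.isCovariantDerivativeOnUniv
      D.isCovariantDerivativeOnUniv (Set.mem_univ x) hs) v)
  refine ⟨⟨B, fun X s ↦ ?_⟩, fun s x hs v ↦ by simp [hB s x hs v]⟩
  exact (((contMDiff_covariantDerivative hD' s).clm_bundle_apply X.contMDiff).sub_section
    ((contMDiff_covariantDerivative hD s).clm_bundle_apply X.contMDiff)).congr
    fun x ↦ congrArg _ (hB s x s.mdifferentiableAt (X x))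

end ChangeOfConnection

/-- Uniqueness is stated at points where the section is differentiable: the axioms of
`CovariantDerivative` leave its values on other sections arbitrary, and these carry no geometric
information. -/
theorem theorem2
    {E : Type*} [NormedAddCommGroup E] [NormedSpace ℝ E] [FiniteDimensional ℝ E]
    {M : Type*} [TopologicalSpace M] [T2Space M] [SigmaCompactSpace M]
    [ChartedSpace E M] [IsManifold 𝓘(ℝ, E) ∞ M]
    {F : Type*} [NormedAddCommGroup F] [NormedSpace ℝ F] [FiniteDimensional ℝ F]
    {V : M → Type*} [TopologicalSpace (TotalSpace F V)]
    [∀ x, AddCommGroup (V x)] [∀ x, Module ℝ (V x)] [∀ x, TopologicalSpace (V x)]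
    [∀ x, IsTopologicalAddGroup (V x)] [∀ x, ContinuousSMul ℝ (V x)]
    [FiberBundle F V] [VectorBundle ℝ F V] [ContMDiffVectorBundle ∞ F V 𝓘(ℝ, E)]
    (A : Sections E F V →ₗ[ℝ] Sections E F V) (hA : IsDiffOp 2 A)
    (σ : SymbolsTwo E F V) (hσ : IsSymbolTwo (fun s ↦ ⇑(A s)) σ) (hreg : IsRegularSymbol σ)
    (Dc : CovariantDerivative 𝓘(ℝ, E) (E →L[ℝ] ℝ) (fun x : M ↦ Cotangent E x))
    (hDc : CovariantDerivative.ContMDiffCovariantDerivative Dc ∞) :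
    ∃ D : CovariantDerivative 𝓘(ℝ, E) F V,
      (CovariantDerivative.ContMDiffCovariantDerivative D ∞ ∧ IsSubsymbolOne Dc D A σ 0) ∧
      ∀ D' : CovariantDerivative 𝓘(ℝ, E) F V,
        CovariantDerivative.ContMDiffCovariantDerivative D' ∞ → IsSubsymbolOne Dc D' A σ 0 →
        ∀ (s : Π x, V x) (x : M),
          MDifferentiableAt 𝓘(ℝ, E) (𝓘(ℝ, E).prod 𝓘(ℝ, F)) (fun y ↦ TotalSpace.mk' F y (s y)) x →
          D' s x = D s x := by
  obtain ⟨D₀, hD₀⟩ := exists_contMDiffCovariantDerivative (E := E) (F := F) (V := V)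
  obtain ⟨τ, hτ⟩ := exists_isSubsymbolOne hσ hDc hD₀
  -- Surjectivity half of regularity: adding α to ∇₀ raises the symbol of the quantization by ⟨σ, α⟩
  -- = τ, exactly the subsymbol to be removed.
  obtain ⟨α, hα, -⟩ := hreg τ
  obtain ⟨D, hD, hDα⟩ := exists_covariantDerivative_eq_add hD₀ α
  have hzero : ∀ (f : C^∞⟮𝓘(ℝ, E), M; 𝓘(ℝ, ℝ), ℝ⟯) (s : Sections E F V) (x : M),
      (0 : SymbolsOne E F V) x (mvfderiv 𝓘(ℝ, E) f x) (s x) = 0 := fun _ _ _ ↦ rfl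
  have hDA : IsSubsymbolOne Dc D A σ 0 := by
    intro f s x
    have h := hτ f s x
    rw [funCommutator_sub] at h
    rw [funCommutator_sub, funCommutator_quantizeTwo_of_eq_add Dc hD₀ hD σ f (hDα s x), hα,
      ← sub_sub, h, sub_self, hzero]
  refine ⟨D, ⟨hD, hDA⟩, fun D' hD' hD'A s x hs ↦ ?_⟩
  obtain ⟨β, hβ⟩ := exists_endForms_eq_sub hD hD'
  have hβ₀ : ∀ x, pairing x (σ x) (β x) = (0 : SymbolsOne E F V) x := by
    intro x
    refine cotangent_hom_ext (F := F) fun f s ↦ ?_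
    have h := hDA f s x
    have h' := hD'A f s x
    rw [funCommutator_sub] at h h'
    rw [funCommutator_quantizeTwo_of_eq_add Dc hD hD' σ f (hβ s x s.mdifferentiableAt),
      ← sub_sub, h, hzero, zero_sub, neg_eq_zero] at h'
    rw [h', hzero]
  have hz : ∀ x, pairing x (σ x) ((⟨0, fun _ _ ↦ contMDiff_zeroSection ℝ V⟩ :
      EndForms E F V) x) = (0 : SymbolsOne E F V) x := by
    intro x
    ext θ v
    rw [pairing_apply]
    exact Finset.sum_eq_zero fun i _ ↦ map_zero _
  -- Injectivity half of regularity: β and the zero form both pair with σ to 0.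
  have hβz := (hreg 0).unique hβ₀ hz
  ext v
  rw [hβ s x hs v, hβz]
  exact add_zero _
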